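/- Let $n\ge 1$ be an integer and let $\Omega\subset\mathbb R^n$ be a bounded $C^{1,1}$ domain (a bounded, nonempty, open, connected set with $C^{1,1}$ boundary). Let $\mathbf A$ be a nonempty finite set, with its discrete $\sigma$-algebra, and let $\mathbf B$ be a nonempty compact metric space, with its Borel $\sigma$-algebra. Let $b^1,\dots,b^n,c,f:\Omega\times\mathbf A\times\mathbf B\to\mathbb R$ be functions such that each $\phi\in\{b^1,\dots,b^n,c,f\}$ is Lebesgue measurable in $x$ for fixed $(\alpha,\beta)$, is continuous in $\beta$ for every fixed $(x,\alpha)\in\Omega\times\mathbf A$, and is essentially bounded: there is a constant $C$ such that for almost every $x\in\Omega$ one has $|\phi(x,\alpha,\beta)|\le C$ for all $(\alpha,\beta)$. Let $1\le p<\infty$, and if $n>2$ assume in addition that $p<\frac{2n}{n-2}$. Equip $(L^p(\Omega))^{|\mathbf A|}$ with the norm $\sum_{\alpha\in\mathbf A}\|u(\cdot,\alpha)\|_{L^p(\Omega)}$, and write (summing over $i=1,\dots,n$) $$\ell(x,z,q,\alpha,\beta)=b^i(x,\alpha,\beta)q_i+c(x,\alpha,\beta)z-f(x,\alpha,\beta),\qquad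 z\in\mathbb R,\ q\in\mathbb R^n .$$ For $u\in H^2(\Omega)$, a *minimizing selector for $u$* is a map $\beta^u:\Omega\times\mathbf A\to\mathbf B$, measurable for the product of the $\sigma$-algebra of Lebesgue measurable subsets of $\Omega$ and the $\sigma$-algebra of $\mathbf A$, such that for almost every $x\in\Omega$ and all $\alpha\in\mathbf A$, $$\beta^u(x,\alpha)\in\operatorname*{arg\,min}_{\beta\in\mathbf B}\ \ell\big(x,u(x),\nabla u(x),\alpha,\beta\big).$$ Then the following hold. 1. For every $u\in H^2(\Omega)$ and all pointwise representatives of $u$ and $\nabla u$, there is a jointly measurable $\beta^u:\Omega\times\mathbf A\to\mathbf B$ that satisfies the minimizing condition, with these representatives, at every $x\in\Omega$ and for every $\alpha\in\mathbf A$. 2. For every $u\in H^2(\Omega)$ and every minimizing selector $\beta^u$ for $u$, the formula $$v\mapsto\Big(b^i(\cdot,\alpha,\beta^u(\cdot,\alpha))\,\partial_i v+c(\cdot,\alpha,\beta^u(\cdot,\alpha))\,v\Big)_{\alpha\in\mathbf A}$$ defines a bounded linear operator from $H^2(\Omega)$ to $(L^p(\Omega))^{|\mathbf A|}$. Let $\partial^*F_1(u)\subset\mathcal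 L\big(H^2(\Omega),(L^p(\Omega))^{|\mathbf A|}\big)$ denote the set of all operators obtained in this way from minimizing selectors for $u$. 3. The HJB operator $$F_1(u)=\Big(\min_{\beta\in\mathbf B}\big(b^i(\cdot,\alpha,\beta)\,\partial_i u+c(\cdot,\alpha,\beta)\,u-f(\cdot,\alpha,\beta)\big)\Big)_{\alpha\in\mathbf A}$$ is a well-defined map from $H^2(\Omega)$ to $(L^p(\Omega))^{|\mathbf A|}$, it is (globally) Lipschitz continuous, and it is $\partial^*F_1$-semismooth in $H^2(\Omega)$: for every $u\in H^2(\Omega)$ the set $\partial^*F_1(u)$ is nonempty, $F_1$ is continuous near $u$, and $$\sup_{M\in\partial^*F_1(u+s)}\big\|F_1(u+s)-F_1(u)-Ms\big\|_{(L^p(\Omega))^{|\mathbf A|}}=o\big(\|s\|_{H^2(\Omega)}\big)\qquad\text{as }\|s\|_{H^2(\Omega)}\to0 .$$ -/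

import Mathlib

open MeasureTheory Filter Topology
open scoped NNReal ENNReal ContDiff

namespace HJB

/-- `ℝⁿ` with its Euclidean norm. -/
abbrev E (n : ℕ) : Type := EuclideanSpace ℝ (Fin n)

/-- Lebesgue measure on the set `Ω`. -/
noncomputable abbrev leb {n : ℕ} (Ω : Set (E n)) : Measure (E n) := volume.restrict Ω

/-- A bounded `C^{1,1}` domain of `ℝⁿ`: a nonempty bounded open connected set which, near each of
its boundary points `x₀`, is the strict epigraph of a `C^{1,1}` function `φ` in a suitable
orthonormal coordinate system. The unit vector `e` is the vertical axis of that system, `⟪e, x⟫` is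
the vertical coordinate of `x`, and `x - ⟪e, x⟫ e` is the projection of `x` to the horizontal
hyperplane `e^⊥` (only the values of `φ` on this hyperplane matter). -/
structure IsBoundedC11Domain {n : ℕ} (Ω : Set (E n)) : Prop where
  isOpen : IsOpen Ω
  isConnected : IsConnected Ω
  isBounded : Bornology.IsBounded Ω
  boundary : ∀ x₀ ∈ frontier Ω, ∃ e : E n, ‖e‖ = 1 ∧ ∃ r > 0, ∃ φ : E n → ℝ,
    ContDiff ℝ 1 φ ∧ (∃ K : ℝ≥0, LipschitzWith K (fderiv ℝ φ)) ∧
      ∀ x ∈ Metric.ball x₀ r,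
        (x ∈ Ω ↔ φ (x - (inner ℝ e x : ℝ) • e) < (inner ℝ e x : ℝ))

/-- `g` is the weak partial derivative `∂ᵢ u` on `Ω` (used below for `u, g ∈ L²(Ω)`): the
integration by parts formula holds for all smooth test functions with compact support in `Ω`. -/
def IsWeakPartial {n : ℕ} (Ω : Set (E n)) (i : Fin n) (u g : E n → ℝ) : Prop :=
  ∀ φ : E n → ℝ, ContDiff ℝ ∞ φ → HasCompactSupport φ → tsupport φ ⊆ Ω →
    ∫ x, u x * fderiv ℝ φ x (EuclideanSpace.single i 1) ∂(leb Ω) = -∫ x, g x * φ x ∂(leb Ω)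

theorem memLp_test {n : ℕ} {Ω : Set (E n)} {φ : E n → ℝ} (hφ : ContDiff ℝ ∞ φ)
    (hc : HasCompactSupport φ) : MemLp φ 2 (leb Ω) :=
  (hφ.continuous.memLp_of_hasCompactSupport hc).restrict Ω

theorem memLp_fderiv_test {n : ℕ} {Ω : Set (E n)} {φ : E n → ℝ} (hφ : ContDiff ℝ ∞ φ)
    (hc : HasCompactSupport φ) (e : E n) : MemLp (fun x => fderiv ℝ φ x e) 2 (leb Ω) := by
  refine (Continuous.memLp_of_hasCompactSupport ?_ ?_).restrict Ω
  · exact (hφ.continuous_fderiv (by simp)).clm_apply continuous_const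
  · exact hc.fderiv_apply ℝ e

theorem isWeakPartial_zero {n : ℕ} (Ω : Set (E n)) (i : Fin n) :
    IsWeakPartial Ω i ((0 : Lp ℝ 2 (leb Ω)) : E n → ℝ) ((0 : Lp ℝ 2 (leb Ω)) : E n → ℝ) := by
  intro φ _ _ _
  have h := Lp.coeFn_zero ℝ 2 (leb Ω)
  rw [integral_eq_zero_of_ae, integral_eq_zero_of_ae, neg_zero]
  · filter_upwards [h] with x hx
    rw [hx, Pi.zero_apply, zero_mul]
  · filter_upwards [h] with x hx
    rw [hx, Pi.zero_apply, zero_mul]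

theorem isWeakPartial_add {n : ℕ} {Ω : Set (E n)} {i : Fin n} {u v g h : Lp ℝ 2 (leb Ω)}
    (hu : IsWeakPartial Ω i u g) (hv : IsWeakPartial Ω i v h) :
    IsWeakPartial Ω i (u + v : Lp ℝ 2 (leb Ω)) (g + h : Lp ℝ 2 (leb Ω)) := by
  intro φ h1 h2 h3
  have key : ∀ (a b : Lp ℝ 2 (leb Ω)) (ψ : E n → ℝ), MemLp ψ 2 (leb Ω) →
      ∫ x, ((a + b : Lp ℝ 2 (leb Ω)) : E n → ℝ) x * ψ x ∂(leb Ω)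
        = ∫ x, a x * ψ x ∂(leb Ω) + ∫ x, b x * ψ x ∂(leb Ω) := by
    intro a b ψ hψ
    have ia : Integrable (fun x => a x * ψ x) (leb Ω) := (Lp.memLp a).integrable_mul hψ
    have ib : Integrable (fun x => b x * ψ x) (leb Ω) := (Lp.memLp b).integrable_mul hψ
    rw [← integral_add ia ib]
    refine integral_congr_ae ?_
    filter_upwards [Lp.coeFn_add a b] with x hx
    rw [hx, Pi.add_apply, add_mul]
  rw [key _ _ _ (memLp_fderiv_test h1 h2 _), key _ _ _ (memLp_test h1 h2), hu φ h1 h2 h3,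
    hv φ h1 h2 h3]
  ring

theorem isWeakPartial_smul {n : ℕ} {Ω : Set (E n)} {i : Fin n} (t : ℝ) {u g : Lp ℝ 2 (leb Ω)}
    (hu : IsWeakPartial Ω i u g) :
    IsWeakPartial Ω i (t • u : Lp ℝ 2 (leb Ω)) (t • g : Lp ℝ 2 (leb Ω)) := by
  intro φ h1 h2 h3
  have key : ∀ (a : Lp ℝ 2 (leb Ω)) (ψ : E n → ℝ),
      ∫ x, ((t • a : Lp ℝ 2 (leb Ω)) : E n → ℝ) x * ψ x ∂(leb Ω)
        = t * ∫ x, a x * ψ x ∂(leb Ω) := by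
    intro a ψ
    rw [← integral_const_mul]
    refine integral_congr_ae ?_
    filter_upwards [Lp.coeFn_smul t a] with x hx
    rw [hx, Pi.smul_apply, smul_eq_mul, mul_assoc]
  rw [key, key, hu φ h1 h2 h3]
  ring

/-- Labels of the derivatives of order at most two: `inl ()` stands for the function itself,
`inr (inl i)` for `∂ᵢ`, and `inr (inr (i, j))` for `∂ⱼ∂ᵢ`. -/
abbrev Label (n : ℕ) : Type := Unit ⊕ (Fin n ⊕ (Fin n × Fin n))

/-- The Sobolev space `H²(Ω)`: the families `(u, (∂ᵢu)ᵢ, (∂ⱼ∂ᵢu)ᵢⱼ)` of a function `u ∈ L²(Ω)` and its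
weak derivatives of order one and two, all in `L²(Ω)`. The norm inherited from the `ℓ²`-product is
`(‖u‖² + ∑ᵢ ‖∂ᵢu‖² + ∑ᵢⱼ ‖∂ⱼ∂ᵢu‖²)^{1/2}` with `L²(Ω)`-norms. -/
noncomputable def H2Submodule {n : ℕ} (Ω : Set (E n)) :
    Submodule ℝ (PiLp 2 fun _ : Label n => Lp ℝ 2 (leb Ω)) where
  carrier := {U | (∀ i, IsWeakPartial Ω i (U (.inl ())) (U (.inr (.inl i)))) ∧
    ∀ i j, IsWeakPartial Ω j (U (.inr (.inl i))) (U (.inr (.inr (i, j))))}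
  zero_mem' := ⟨fun i => isWeakPartial_zero Ω i, fun _ j => isWeakPartial_zero Ω j⟩
  add_mem' := fun hU hV =>
    ⟨fun i => isWeakPartial_add (hU.1 i) (hV.1 i),
      fun i j => isWeakPartial_add (hU.2 i j) (hV.2 i j)⟩
  smul_mem' := fun t _ hU =>
    ⟨fun i => isWeakPartial_smul t (hU.1 i), fun i j => isWeakPartial_smul t (hU.2 i j)⟩

/-- The Sobolev space `H²(Ω)`, as a normed space. -/
abbrev H2 {n : ℕ} (Ω : Set (E n)) : Type := H2Submodule Ω

/-- The element `u ∈ H²(Ω)` as an element of `L²(Ω)`. -/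
noncomputable def H2.fn {n : ℕ} {Ω : Set (E n)} (u : H2 Ω) : Lp ℝ 2 (leb Ω) := u.1 (.inl ())

/-- The weak partial derivative `∂ᵢ u` of `u ∈ H²(Ω)`. -/
noncomputable def H2.partialDeriv {n : ℕ} {Ω : Set (E n)} (u : H2 Ω) (i : Fin n) :
    Lp ℝ 2 (leb Ω) :=
  u.1 (.inr (.inl i))

/-- The space `(L^p(Ω))^{|A|}` with the norm `∑_{α ∈ A} ‖u(·, α)‖_{L^p(Ω)}`. -/
abbrev LpFamily {n : ℕ} (A : Type*) (p : ℝ≥0∞) (Ω : Set (E n)) : Type _ :=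
  PiLp 1 fun _ : A => Lp ℝ p (leb Ω)

/-- Bounded Carathéodory coefficients `φ ∈ L^∞(Ω × A × B)`: `φ(·, α, β)` is Lebesgue measurable on
`Ω`, `φ(x, α, ·)` is continuous for all `x ∈ Ω` and `α ∈ A`, and `φ` is essentially bounded. -/
structure IsCoefficient {n : ℕ} {A B : Type*} [TopologicalSpace B] (Ω : Set (E n))
    (φ : E n → A → B → ℝ) : Prop where
  measurable : ∀ α β, AEMeasurable (fun x => φ x α β) (leb Ω)
  continuous : ∀ x ∈ Ω, ∀ α, Continuous (φ x α)
  bounded : ∃ C : ℝ, ∀ᵐ x ∂(leb Ω), ∀ α β, |φ x α β| ≤ C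

/-- `ℓ(x, (z, q), α, β) = ∑ᵢ bⁱ(x, α, β) qᵢ + c(x, α, β) z - f(x, α, β)`. -/
noncomputable def hamiltonian {n : ℕ} {A B : Type*} (b : Fin n → E n → A → B → ℝ)
    (c f : E n → A → B → ℝ) (x : E n) (z : ℝ) (q : Fin n → ℝ) (α : A) (β : B) : ℝ :=
  ∑ i, b i x α β * q i + c x α β * z - f x α β

/-- Joint measurability of `β : Ω × A → B`, with respect to the product of the `σ`-algebra of
Lebesgue measurable sets on `Ω` and the `σ`-algebra of `A`. -/
def JointlyMeasurable {n : ℕ} {A B : Type*} [MeasurableSpace A] [MeasurableSpace B]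
    (Ω : Set (E n)) (β : E n → A → B) : Prop :=
  Measurable (fun y : NullMeasurableSpace (E n) (leb Ω) × A => β y.1 y.2)

/-- `β` is a jointly measurable minimizing selector for `u ∈ H²(Ω)`:
`β(x, α) ∈ argmin_{β'} (bⁱ(x, α, β') ∂ᵢu(x) + c(x, α, β') u(x) - f(x, α, β'))`. As `u` and `∂ᵢu` are
defined up to null sets, the condition is imposed at almost every `x ∈ Ω`. -/
def IsMinSelector {n : ℕ} {A B : Type*} [MeasurableSpace A] [MeasurableSpace B] {Ω : Set (E n)}
    (b : Fin n → E n → A → B → ℝ) (c f : E n → A → B → ℝ) (u : H2 Ω) (β : E n → A → B) : Prop :=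
  JointlyMeasurable Ω β ∧ ∀ᵐ x ∂(leb Ω), ∀ α β',
    hamiltonian b c f x (u.fn x) (fun i => u.partialDeriv i x) α (β x α) ≤
      hamiltonian b c f x (u.fn x) (fun i => u.partialDeriv i x) α β'

/-- `M` is the operator `v ↦ (bⁱ(·, α, β(·, α)) ∂ᵢv + c(·, α, β(·, α)) v)_{α ∈ A}`. -/
def IsControlledOperator {n : ℕ} {A B : Type*} [Fintype A] {p : ℝ≥0∞} [Fact (1 ≤ p)]
    {Ω : Set (E n)} (b : Fin n → E n → A → B → ℝ) (c : E n → A → B → ℝ) (β : E n → A → B)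
    (M : H2 Ω →L[ℝ] LpFamily A p Ω) : Prop :=
  ∀ v α, M v α =ᵐ[leb Ω]
    fun x => ∑ i, b i x α (β x α) * v.partialDeriv i x + c x α (β x α) * v.fn x

/-- The generalized differential of the HJB operator at `u`: all the operators
`v ↦ (bⁱ(·, α, β(·, α)) ∂ᵢv + c(·, α, β(·, α)) v)_{α ∈ A}` in `𝓛(H²(Ω), (L^p(Ω))^{|A|})` that arise
from jointly measurable minimizing selectors `β` for `u`. -/
def genDiff {n : ℕ} {A B : Type*} [Fintype A] [MeasurableSpace A] [MeasurableSpace B]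
    {Ω : Set (E n)} (p : ℝ≥0∞) [Fact (1 ≤ p)]
    (b : Fin n → E n → A → B → ℝ) (c f : E n → A → B → ℝ) (u : H2 Ω) :
    Set (H2 Ω →L[ℝ] LpFamily A p Ω) :=
  {M | ∃ β : E n → A → B, IsMinSelector b c f u β ∧ IsControlledOperator b c β M}

/-- `F` is `D`-semismooth in the open set `V`: at each `y ∈ V` the set `D y` is nonempty, `F` is
continuous near `y`, and `sup_{M ∈ D (y + s)} ‖F (y + s) - F y - M s‖ = o(‖s‖)` as `‖s‖ → 0`. -/
structure IsSemismooth {Y Z : Type*} [NormedAddCommGroup Y] [NormedSpace ℝ Y]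
    [NormedAddCommGroup Z] [NormedSpace ℝ Z] (F : Y → Z) (D : Y → Set (Y →L[ℝ] Z))
    (V : Set Y) : Prop where
  isOpen : IsOpen V
  nonempty : ∀ y ∈ V, (D y).Nonempty
  continuous : ∀ y ∈ V, ∀ᶠ y' in 𝓝 y, ContinuousAt F y'
  littleO : ∀ y ∈ V, ∀ ε > 0, ∀ᶠ s in 𝓝 (0 : Y), ∀ M ∈ D (y + s),
    ‖F (y + s) - F y - M s‖ ≤ ε * ‖s‖

end HJB

/-! The core is pointwise. For fixed `α` and almost every `x`, the operator is the minimum over a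
compact set of affine functions of the jet `(u, ∇u)`, with slopes bounded independently of `x`. Such
a minimum is Lipschitz, and by compactness a minimizer at a perturbed jet `y + s` has a slope close
to one active at `y`. Hence the slopes active at `y + s` linearize the minimum up to `o(|s|)`
(`exists_forall_abs_iInf_affine_le`).

The rate of this `o(|s|)` depends on `x`, so a norm gap is needed. The remainder is also `O(|s|)`
uniformly in `x`; the quotient of the two is therefore bounded, and where it tends to zero almost
everywhere it tends to zero in every `L^r`, `r < ∞`. Hölder's inequality with `1/p = 1/r + 1/q`
turns this into an `L^p` bound by `o(1)` times the `L^q` norm of the jet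
(`exists_tendsto_zero_eLpNorm'_le`). The assumption on `p` leaves room for some `q > p` with `n(1/2
- 1/q) < 1`, for which `H¹(Ω)` embeds in `L^q(Ω)`; this is applied to `u` and to each `∂ᵢu`.

The embedding rests on interior cones. Average `u` against a kernel supported in a cone with apex
`x` inside `Ω`. The derivative of the average in the scale involves only `∇u`, so telescoping over
dyadic scales bounds `|u(x)|` by integrals over balls (`ae_enorm_le_ballIntegral`). Each ball
integral maps `L²` to `L^q`, and the constants sum geometrically. The graph condition gives a
uniform cone near each point of the closure, and compactness patches the local bounds.

Selectors exist because a minimizer of a Carathéodory function on a compact metric space can be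
singled out measurably by prescribing its distances to a dense sequence
(`exists_measurable_argmin`). -/

namespace HJB

/-! ### Measurable selection of minimizers. -/

section Selection

variable {X B : Type*} [MeasurableSpace X] [MetricSpace B] [CompactSpace B]

/-- On the compact set `C` the infimum of `h x` is attained, so a zero exists as soon as arbitrarily
small values occur. By continuity these can be sought in a countable dense subset of `C`. -/
theorem measurableSet_exists_mem_eq_zero {h : X → B → ℝ} (hm : ∀ β, Measurable fun x => h x β)
    (hc : ∀ x, Continuous (h x)) (h0 : ∀ x β, 0 ≤ h x β) {C : Set B} (hC : IsClosed C) :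
    MeasurableSet {x | ∃ β ∈ C, h x β = 0} := by
  obtain ⟨D, hDC, hD, hCD⟩ :=
    (TopologicalSpace.IsSeparable.of_separableSpace C).exists_countable_dense_subset
  have key : {x | ∃ β ∈ C, h x β = 0} = ⋂ k : ℕ, ⋃ d ∈ D, {x | h x d < 1 / ((k : ℝ) + 1)} := by
    ext x
    simp only [Set.mem_ofPred_eq, Set.mem_iInter, Set.mem_iUnion, exists_prop]
    constructor
    · rintro ⟨β, hβ, hz⟩ k
      have hopen : IsOpen {β | h x β < 1 / ((k : ℝ) + 1)} := isOpen_lt (hc x) continuous_const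
      have hmem : β ∈ {β | h x β < 1 / ((k : ℝ) + 1)} := by
        simp only [Set.mem_ofPred_eq, hz]; positivity
      obtain ⟨d, hd, hdD⟩ := mem_closure_iff.1 (hCD hβ) _ hopen hmem
      exact ⟨d, hdD, hd⟩
    · intro hx
      obtain ⟨d₀, hd₀, -⟩ := hx 0
      obtain ⟨β, hβ, hmin⟩ := hC.isCompact.exists_isMinOn ⟨d₀, hDC hd₀⟩ (hc x).continuousOn
      refine ⟨β, hβ, le_antisymm (le_of_forall_pos_le_add fun ε hε => ?_) (h0 x β)⟩
      obtain ⟨k, hk⟩ := exists_nat_one_div_lt hε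
      obtain ⟨d, hd, hlt⟩ := hx k
      have := isMinOn_iff.1 hmin d (hDC hd)
      linarith
  rw [key]
  exact .iInter fun k => .biUnion hD fun d _ => measurableSet_lt (hm d) measurable_const

/-- The choice of `m x` is the least value of `g` on the zero set. It is measurable because `m x ≤
a` means that the zero set meets the closed set `{g ≤ a}`. -/
theorem exists_measurable_value_on_zero {h : X → B → ℝ} (hm : ∀ β, Measurable fun x => h x β)
    (hc : ∀ x, Continuous (h x)) (h0 : ∀ x β, 0 ≤ h x β) (hz : ∀ x, ∃ β, h x β = 0)
    {g : B → ℝ} (hg : Continuous g) :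
    ∃ m : X → ℝ, Measurable m ∧ ∀ x, ∃ β, h x β = 0 ∧ g β = m x := by
  have hmin : ∀ x, ∃ β, h x β = 0 ∧ ∀ β', h x β' = 0 → g β ≤ g β' := by
    intro x
    obtain ⟨β, hβ, hmin⟩ := (isClosed_eq (hc x) continuous_const).isCompact.exists_isMinOn
      (hz x) hg.continuousOn
    exact ⟨β, hβ, fun β' h' => isMinOn_iff.1 hmin β' h'⟩
  choose β hβ hβmin using hmin
  refine ⟨fun x => g (β x), measurable_of_Iic fun a => ?_, fun x => ⟨β x, hβ x, rfl⟩⟩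
  convert measurableSet_exists_mem_eq_zero hm hc h0 (isClosed_le hg (continuous_const (y := a)))
    using 1
  ext x
  simp only [Set.mem_preimage, Set.mem_Iic, Set.mem_ofPred_eq]
  exact ⟨fun hx => ⟨β x, hx, hβ x⟩, fun ⟨β', h1, h2⟩ => (hβmin x β' h2).trans h1⟩

theorem measurable_iInf_of_continuous [Nonempty B] {h : X → B → ℝ}
    (hm : ∀ β, Measurable fun x => h x β) (hc : ∀ x, Continuous (h x)) :
    Measurable fun x => ⨅ β, h x β := by
  refine measurable_of_Iio fun a => ?_
  have key : (fun x => ⨅ β, h x β) ⁻¹' Set.Iio a =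
      ⋃ k, {x | h x (TopologicalSpace.denseSeq B k) < a} := by
    ext x
    simp only [Set.mem_preimage, Set.mem_Iio, Set.mem_iUnion, Set.mem_ofPred_eq]
    constructor
    · intro hx
      obtain ⟨β, hβ⟩ := exists_lt_of_ciInf_lt hx
      exact (TopologicalSpace.denseRange_denseSeq B).exists_mem_open
        (isOpen_lt (hc x) (continuous_const (y := a))) ⟨β, hβ⟩
    · rintro ⟨k, hk⟩
      exact (ciInf_le (isCompact_range (hc x)).bddBelow _).trans_lt hk
  rw [key]
  exact .iUnion fun k => measurableSet_lt (hm _) measurable_const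

/-- Measurable selection of a minimizer of a Carathéodory function on a compact metric space. -/
theorem exists_measurable_argmin [Nonempty B] [MeasurableSpace B] [BorelSpace B] {h : X → B → ℝ}
    (hm : ∀ β, Measurable fun x => h x β) (hc : ∀ x, Continuous (h x)) :
    ∃ β : X → B, Measurable β ∧ ∀ x β', h x (β x) ≤ h x β' := by
  -- An element of `S` encodes a nonempty compact set depending measurably on `x`, as the zero set
  -- of a nonnegative Carathéodory function. The initial one encodes the set of minimizers.
  let S := {g : X → B → ℝ // (∀ β, Measurable fun x => g x β) ∧ (∀ x, Continuous (g x)) ∧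
    (∀ x β, 0 ≤ g x β) ∧ ∀ x, ∃ β, g x β = 0}
  have hbdd : ∀ x, BddBelow (Set.range (h x)) := fun x => (isCompact_range (hc x)).bddBelow
  have hatt : ∀ x, ∃ β, h x β = ⨅ β, h x β := by
    intro x
    obtain ⟨β, -, hβ⟩ := isCompact_univ.exists_isMinOn Set.univ_nonempty (hc x).continuousOn
    exact ⟨β, le_antisymm (le_ciInf fun β' => isMinOn_iff.1 hβ β' trivial) (ciInf_le (hbdd x) β)⟩
  let s₀ : S := ⟨fun x β => h x β - ⨅ β, h x β,
    fun β => (hm β).sub (measurable_iInf_of_continuous hm hc),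
    fun x => (hc x).sub continuous_const, fun x β => sub_nonneg.2 (ciInf_le (hbdd x) β),
    fun x => (hatt x).imp fun β hβ => sub_eq_zero.2 hβ⟩
  let d := TopologicalSpace.denseSeq B
  have hstep : ∀ (s : S) (k : ℕ), ∃ (s' : S) (m : X → ℝ), Measurable m ∧
      ∀ x β, s'.1 x β = 0 → s.1 x β = 0 ∧ dist β (d k) = m x := by
    rintro ⟨g, g1, g2, g3, g4⟩ k
    obtain ⟨m, hm, hmz⟩ := exists_measurable_value_on_zero g1 g2 g3 g4
      (continuous_id.dist (continuous_const (y := d k)))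
    -- Adding a nonnegative penalty intersects the zero set with the sphere of radius `m x` around
    -- `d k`.
    refine ⟨⟨fun x β => g x β + |dist β (d k) - m x|, fun β => ?_, fun x => ?_, fun x β => ?_,
      fun x => ?_⟩, m, hm, fun x β hβ => ?_⟩
    · exact (g1 β).add (measurable_const.sub hm).abs
    · exact (g2 x).add ((continuous_id.dist continuous_const).sub continuous_const).abs
    · exact add_nonneg (g3 x β) (abs_nonneg _)
    · obtain ⟨β, h1, h2⟩ := hmz x
      exact ⟨β, by simp only [id] at h2; simp [h1, h2]⟩
    · have h1 := g3 x β
      have h2 := abs_nonneg (dist β (d k) - m x)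
      have h3 : g x β + |dist β (d k) - m x| = 0 := hβ
      exact ⟨by linarith, sub_eq_zero.1 (abs_eq_zero.1 (by linarith))⟩
  choose next m hmm hnext using hstep
  let H : ℕ → S := fun k => Nat.rec s₀ (fun k s => next s k) k
  have hH : ∀ k, H (k + 1) = next (H k) k := fun k => rfl
  have hinter : ∀ x, (⋂ k, {β | (H k).1 x β = 0}).Nonempty := by
    intro x
    refine IsCompact.nonempty_iInter_of_sequence_nonempty_isCompact_isClosed _ (fun k β hβ => ?_)
      (fun k => (H k).2.2.2.2 x) (isClosed_eq ((H 0).2.2.1 x) continuous_const).isCompact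
      (fun k => isClosed_eq ((H k).2.2.1 x) continuous_const)
    exact (hnext (H k) k x β hβ).1
  choose β hβ using hinter
  simp only [Set.mem_iInter, Set.mem_ofPred_eq] at hβ
  refine ⟨β, ?_, fun x β' => ?_⟩
  -- Distances to a dense sequence determine a point, so `Φ` is a continuous injection of a compact
  -- metric space and thus a measurable embedding. The coordinates of `Φ ∘ β` are the measurable
  -- functions prescribed during the recursion.
  · let Φ : B → ℕ → ℝ := fun b k => dist b (d k)
    have hΦc : Continuous Φ := continuous_pi fun k => continuous_id.dist continuous_const
    have hΦi : Function.Injective Φ := by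
      intro b b' hbb
      by_contra hne
      have hpos : 0 < dist b b' / 2 := half_pos (dist_pos.2 hne)
      obtain ⟨k, hk⟩ := (TopologicalSpace.denseRange_denseSeq B).exists_dist_lt b hpos
      have h1 : dist b (d k) = dist b' (d k) := congrFun hbb k
      have h2 := dist_triangle_right b b' (d k)
      have h3 : dist b (d k) < dist b b' / 2 := hk
      linarith
    have hemb := hΦc.measurableEmbedding hΦi
    refine hemb.measurable_comp_iff.1 (measurable_pi_iff.2 fun k => ?_)
    convert hmm (H k) k using 1
    funext x
    exact (hnext (H k) k x (β x) (hβ x (k + 1))).2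
  · have h1 : h x (β x) - ⨅ β, h x β = 0 := hβ x 0
    have h2 := ciInf_le (hbdd x) β'
    linarith

end Selection

/-! ### Integrals over balls as operators from `L²` to `L^q`. -/

section BallIntegral

variable {n : ℕ}

/-- The integral of `F` over the closed ball of radius `r` around `x`. -/
noncomputable def ballIntegral (F : E n → ℝ≥0∞) (r : ℝ) (x : E n) : ℝ≥0∞ :=
  ∫⁻ y in Metric.closedBall x r, F y

theorem ballIntegral_eq_lintegral_indicator (F : E n → ℝ≥0∞) (r : ℝ) (x : E n) :
    ballIntegral F r x =
      ∫⁻ y, {z : E n × E n | dist z.2 z.1 ≤ r}.indicator (fun z => F z.2) (x, y) := by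
  rw [ballIntegral, ← lintegral_indicator Metric.isClosed_closedBall.measurableSet]
  rfl

theorem measurable_ballIntegral_integrand {F : E n → ℝ≥0∞} (hF : Measurable F) (r : ℝ) :
    Measurable ({z : E n × E n | dist z.2 z.1 ≤ r}.indicator fun z => F z.2) :=
  (hF.comp measurable_snd).indicator
    (isClosed_le (continuous_snd.dist continuous_fst) continuous_const).measurableSet

theorem measurable_ballIntegral {F : E n → ℝ≥0∞} (hF : Measurable F) (r : ℝ) :
    Measurable (ballIntegral F r) := by
  simp only [funext (ballIntegral_eq_lintegral_indicator F r)]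
  exact (measurable_ballIntegral_integrand hF r).lintegral_prod_right'

/-- Tonelli: each `y` is counted by exactly those `x` in the ball of radius `r` around it. -/
theorem lintegral_ballIntegral {F : E n → ℝ≥0∞} (hF : Measurable F) (r : ℝ) :
    ∫⁻ x, ballIntegral F r x = volume (Metric.closedBall (0 : E n) r) * ∫⁻ y, F y := by
  simp only [ballIntegral_eq_lintegral_indicator F r]
  rw [lintegral_lintegral_swap
      (f := fun x y => {z : E n × E n | dist z.2 z.1 ≤ r}.indicator (fun z => F z.2) (x, y))
      (measurable_ballIntegral_integrand hF r).aemeasurable, ← lintegral_const_mul _ hF]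
  refine lintegral_congr fun y => ?_
  have h : (fun x => {z : E n × E n | dist z.2 z.1 ≤ r}.indicator (fun z => F z.2) (x, y)) =
      (Metric.closedBall y r).indicator fun _ => F y := by
    funext x
    simp only [Set.indicator, Set.mem_ofPred_eq, Metric.mem_closedBall, dist_comm]
  rw [h, lintegral_indicator Metric.isClosed_closedBall.measurableSet, setLIntegral_const,
    Measure.addHaar_closedBall_center volume y r, mul_comm]

theorem lintegral_rpow_two_le {α : Type*} [MeasurableSpace α] {μ : Measure α} {F : α → ℝ≥0∞}
    (hF : Measurable F) :
    (∫⁻ y, F y ∂μ) ^ (2 : ℝ) ≤ μ Set.univ * ∫⁻ y, F y ^ (2 : ℝ) ∂μ := by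
  have h := ENNReal.lintegral_mul_le_Lp_mul_Lq μ Real.HolderConjugate.two_two
    (measurable_const (a := (1 : ℝ≥0∞))).aemeasurable hF.aemeasurable
  simp only [Pi.mul_apply, one_mul, ENNReal.one_rpow, lintegral_const] at h
  calc (∫⁻ y, F y ∂μ) ^ (2 : ℝ)
      ≤ ((μ Set.univ) ^ (1 / 2 : ℝ) * (∫⁻ y, F y ^ (2 : ℝ) ∂μ) ^ (1 / 2 : ℝ)) ^ (2 : ℝ) := by
        gcongr
    _ = _ := by
        rw [ENNReal.mul_rpow_of_nonneg _ _ (by norm_num), ← ENNReal.rpow_mul, ← ENNReal.rpow_mul]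
        norm_num

/-- The smoothing estimate `L² → L^q` for the unnormalized averages over balls. -/
theorem lintegral_ballIntegral_rpow_le {F : E n → ℝ≥0∞} (hF : Measurable F) (r : ℝ) {q : ℝ}
    (hq : 2 ≤ q) :
    ∫⁻ x, ballIntegral F r x ^ q ≤ volume (Metric.closedBall (0 : E n) r) ^ (q / 2 + 1) *
      (∫⁻ y, F y ^ (2 : ℝ)) ^ (q / 2) := by
  set v := volume (Metric.closedBall (0 : E n) r)
  set N := ∫⁻ y, F y ^ (2 : ℝ)
  have hF2 : Measurable fun y => F y ^ (2 : ℝ) := hF.pow_const _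
  -- Cauchy–Schwarz bounds the square of the ball integral by `v * I`. Of the resulting power `I ^
  -- (q / 2)` all but one factor is estimated by the global integral `N`; the remaining factor `I`
  -- is integrated exactly by Tonelli.
  have hpt : ∀ x, ballIntegral F r x ^ q ≤
      v ^ (q / 2) * N ^ (q / 2 - 1) * ballIntegral (fun y => F y ^ (2 : ℝ)) r x := by
    intro x
    set I := ballIntegral (fun y => F y ^ (2 : ℝ)) r x
    have hI : I ≤ N := setLIntegral_le_lintegral _ _
    have h1 : ballIntegral F r x ^ (2 : ℝ) ≤ v * I := by
      have := lintegral_rpow_two_le (μ := volume.restrict (Metric.closedBall x r)) hF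
      rwa [Measure.restrict_apply_univ, Measure.addHaar_closedBall_center] at this
    calc ballIntegral F r x ^ q = (ballIntegral F r x ^ (2 : ℝ)) ^ (q / 2) := by
          rw [← ENNReal.rpow_mul]; congr 1; ring
      _ ≤ (v * I) ^ (q / 2) := by gcongr
      _ = v ^ (q / 2) * (I ^ (q / 2 - 1) * I) := by
          rw [ENNReal.mul_rpow_of_nonneg _ _ (by linarith)]
          congr 1
          conv_rhs => rw [← ENNReal.rpow_one I, ← ENNReal.rpow_mul, one_mul]
          rw [← ENNReal.rpow_add_of_nonneg _ _ (by linarith) zero_le_one]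
          congr 1; ring
      _ ≤ v ^ (q / 2) * (N ^ (q / 2 - 1) * I) := by
          gcongr
          linarith
      _ = _ := by rw [mul_assoc]
  calc ∫⁻ x, ballIntegral F r x ^ q
      ≤ ∫⁻ x, v ^ (q / 2) * N ^ (q / 2 - 1) * ballIntegral (fun y => F y ^ (2 : ℝ)) r x :=
        lintegral_mono hpt
    _ = v ^ (q / 2) * N ^ (q / 2 - 1) * (v * N) := by
        rw [lintegral_const_mul _ (measurable_ballIntegral hF2 r), lintegral_ballIntegral hF2]
    _ = (v ^ (q / 2) * v) * (N ^ (q / 2 - 1) * N) := by ring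
    _ = _ := by
        congr 1
        · conv_lhs => rw [← ENNReal.rpow_one v, ← ENNReal.rpow_mul, one_mul]
          rw [← ENNReal.rpow_add_of_nonneg _ _ (by linarith) zero_le_one]
        · conv_lhs => rw [← ENNReal.rpow_one N, ← ENNReal.rpow_mul, one_mul]
          rw [← ENNReal.rpow_add_of_nonneg _ _ (by linarith) zero_le_one, sub_add_cancel]

theorem eLpNorm'_ballIntegral_le {F : E n → ℝ≥0∞} (hF : Measurable F) (r : ℝ) {q : ℝ}
    (hq : 2 ≤ q) :
    eLpNorm' (ballIntegral F r) q volume ≤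
      volume (Metric.closedBall (0 : E n) r) ^ (1 / 2 + 1 / q) * eLpNorm' F 2 volume := by
  have hq0 : 0 < q := by linarith
  simp only [eLpNorm', enorm_eq_self]
  calc (∫⁻ x, ballIntegral F r x ^ q) ^ (1 / q)
      ≤ (volume (Metric.closedBall (0 : E n) r) ^ (q / 2 + 1) *
      (∫⁻ y, F y ^ (2 : ℝ)) ^ (q / 2)) ^ (1 / q) := by
        gcongr
        exact lintegral_ballIntegral_rpow_le hF r hq
    _ = _ := by
        rw [ENNReal.mul_rpow_of_nonneg _ _ (by positivity), ← ENNReal.rpow_mul,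
          ← ENNReal.rpow_mul]
        congr 2 <;> field_simp

end BallIntegral

/-- Minkowski's inequality for countable sums, from the finite case by monotone convergence. -/
theorem eLpNorm'_tsum_le {α : Type*} [MeasurableSpace α] {μ : Measure α} {f : ℕ → α → ℝ≥0∞}
    (hf : ∀ k, Measurable (f k)) {q : ℝ} (hq : 1 ≤ q) :
    eLpNorm' (fun x => ∑' k, f k x) q μ ≤ ∑' k, eLpNorm' (f k) q μ := by
  have hq0 : 0 < q := by linarith
  have h1 : ∫⁻ x, (∑' k, f k x) ^ q ∂μ = ⨆ N, ∫⁻ x, (∑ k ∈ Finset.range N, f k x) ^ q ∂μ := by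
    rw [← lintegral_iSup (fun N => (Finset.measurable_sum _ fun k _ => hf k).pow_const q)
      fun N M h x => by
        dsimp only
        gcongr]
    refine lintegral_congr fun x => ?_
    rw [ENNReal.tsum_eq_iSup_nat]
    exact (ENNReal.orderIsoRpow q hq0).map_iSup _
  simp only [eLpNorm', enorm_eq_self]
  have h2 := (ENNReal.orderIsoRpow (1 / q) (by positivity)).map_iSup
    fun N => ∫⁻ x, (∑ k ∈ Finset.range N, f k x) ^ q ∂μ
  simp only [ENNReal.orderIsoRpow_apply] at h2
  rw [h1, h2]
  refine iSup_le fun N => ?_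
  have h3 := eLpNorm'_sum_le (μ := μ) (f := f) (s := Finset.range N)
    (fun k _ => (hf k).aestronglyMeasurable) hq
  simp only [eLpNorm', enorm_eq_self, Finset.sum_apply] at h3
  exact h3.trans (ENNReal.sum_le_tsum _)

/-! ### One-sided mollification and its derivative in the scale. -/

section Mollification

variable {n : ℕ} {Ω : Set (E n)}

theorem tsupport_comp_inv_smul_sub_subset {η : E n → ℝ} {e : E n} {δ : ℝ}
    (hη : tsupport η ⊆ Metric.closedBall e δ) (x : E n) {t : ℝ} (ht : 0 < t) :
    tsupport (fun y => η (t⁻¹ • (y - x))) ⊆ (fun w => x + t • w) '' Metric.closedBall e δ := by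
  refine closure_minimal (fun y hy => ?_)
    ((isCompact_closedBall e δ).image (by fun_prop)).isClosed
  refine ⟨t⁻¹ • (y - x), hη (subset_tsupport _ hy), ?_⟩
  simp only [smul_smul, mul_inv_cancel₀ ht.ne', one_smul, add_sub_cancel]

theorem hasCompactSupport_comp_inv_smul_sub {η : E n → ℝ} {e : E n} {δ : ℝ}
    (hη : tsupport η ⊆ Metric.closedBall e δ) (x : E n) {t : ℝ} (ht : 0 < t) :
    HasCompactSupport fun y => η (t⁻¹ • (y - x)) :=
  ((isCompact_closedBall e δ).image (by fun_prop)).of_isClosed_subset isClosed_closure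
    (tsupport_comp_inv_smul_sub_subset hη x ht)

theorem exists_abs_le_of_tsupport_subset {η : E n → ℝ} {e : E n} {δ : ℝ} (hc : Continuous η)
    (hη : tsupport η ⊆ Metric.closedBall e δ) : ∃ M : ℝ, 0 ≤ M ∧ ∀ w, |η w| ≤ M := by
  obtain ⟨M, hM⟩ := hc.bounded_above_of_compact_support
    (HasCompactSupport.of_support_subset_isCompact (isCompact_closedBall e δ)
      ((subset_tsupport η).trans hη))
  exact ⟨M, (norm_nonneg _).trans (hM 0), hM⟩

/-- The rescaled kernel `y ↦ t⁻ⁿ ρ((y - x) / t)`. -/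
noncomputable def rescale (ρ : E n → ℝ) (x : E n) (t : ℝ) (y : E n) : ℝ :=
  t⁻¹ ^ n * ρ (t⁻¹ • (y - x))

/-- The divergence `n ρ(w) + w · ∇ρ(w)` of the vector field `w ↦ ρ(w) w`. -/
noncomputable def radialDiv (ρ : E n → ℝ) (w : E n) : ℝ := n * ρ w + fderiv ℝ ρ w w

theorem continuous_radialDiv {ρ : E n → ℝ} (hρ : ContDiff ℝ ∞ ρ) : Continuous (radialDiv ρ) :=
  (continuous_const.mul hρ.continuous).add
    ((hρ.continuous_fderiv (by simp)).clm_apply continuous_id)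

theorem tsupport_radialDiv_subset (ρ : E n → ℝ) : tsupport (radialDiv ρ) ⊆ tsupport ρ := by
  refine closure_minimal (fun w hw => ?_) (isClosed_tsupport ρ)
  by_contra h
  refine hw ?_
  have h1 : ρ w = 0 := image_eq_zero_of_notMem_tsupport h
  have h2 : fderiv ℝ ρ w = 0 :=
    image_eq_zero_of_notMem_tsupport fun h' => h (tsupport_fderiv_subset ℝ h')
  simp [radialDiv, h1, h2]

/-- The scale derivative is, up to a factor, the divergence of the compactly supported field `ρ(w)
w`. This is what later allows the derivative to be moved onto `u`. -/
theorem hasDerivAt_rescale {ρ : E n → ℝ} (hρ : ContDiff ℝ ∞ ρ) (x y : E n) {t : ℝ}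
    (ht : 0 < t) :
    HasDerivAt (fun t => rescale ρ x t y) (-(t⁻¹ ^ (n + 1) * radialDiv ρ (t⁻¹ • (y - x)))) t := by
  have h1 : HasDerivAt (fun t : ℝ => t⁻¹) (-(t ^ 2)⁻¹) t := hasDerivAt_inv ht.ne'
  have h2 : HasDerivAt (fun t : ℝ => t⁻¹ • (y - x)) (-(t ^ 2)⁻¹ • (y - x)) t :=
    h1.smul_const _
  have h3 := ((hρ.differentiable (by simp)) (t⁻¹ • (y - x))).hasFDerivAt.comp_hasDerivAt t h2
  have h4 := (h1.pow n).mul h3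
  refine h4.congr_deriv ?_
  have h5 : -(t ^ 2)⁻¹ • (y - x) = (-t⁻¹) • (t⁻¹ • (y - x)) := by
    rw [smul_smul]; congr 1; ring
  simp only [h5, map_smul, smul_eq_mul, radialDiv, Function.comp, Pi.pow_apply]
  -- The power rule produces the exponent `n - 1` in `ℕ`, which is truncated at `n = 0`.
  rcases n with _ | n
  · simp
  · simp only [Nat.add_sub_cancel]
    push_cast
    ring

theorem sum_fderiv_coord_mul_rescaled {ρ : E n → ℝ} (hρ : ContDiff ℝ ∞ ρ) (x y : E n) (t : ℝ) :
    ∑ i, fderiv ℝ (fun y : E n => (fun w : E n => w i * ρ w) (t⁻¹ • (y - x))) y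
      (EuclideanSpace.single i 1) = t⁻¹ * radialDiv ρ (t⁻¹ • (y - x)) := by
  set w := t⁻¹ • (y - x) with hw
  have hd : ∀ i, fderiv ℝ (fun y : E n => (fun w : E n => w i * ρ w) (t⁻¹ • (y - x))) y
      (EuclideanSpace.single i 1) =
      t⁻¹ * (ρ w + w i * fderiv ℝ ρ w (EuclideanSpace.single i 1)) := by
    intro i
    have h1 : HasFDerivAt (fun y : E n => t⁻¹ • (y - x)) (t⁻¹ • ContinuousLinearMap.id ℝ (E n)) y :=
      ((hasFDerivAt_id y).sub_const x).const_smul t⁻¹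
    have h2 : HasFDerivAt (fun w : E n => w i) (EuclideanSpace.proj i : E n →L[ℝ] ℝ) w :=
      (EuclideanSpace.proj i : E n →L[ℝ] ℝ).hasFDerivAt
    have h3 := (hρ.differentiable (by simp) w).hasFDerivAt
    have h4 := (h2.mul h3).comp y h1
    rw [show (fun y : E n => (fun w : E n => w i * ρ w) (t⁻¹ • (y - x))) =
      (fun w : E n => w i * ρ w) ∘ fun y : E n => t⁻¹ • (y - x) from rfl]
    erw [h4.fderiv]
    simp
    ring
  simp only [hd, ← Finset.mul_sum, Finset.sum_add_distrib, radialDiv]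
  congr 2
  · simp
  · have h5 : w = ∑ i, w i • EuclideanSpace.single i (1 : ℝ) := by
      have := (EuclideanSpace.basisFun (Fin n) ℝ).sum_repr w
      simpa using this.symm
    conv_rhs => rw [h5, map_sum]
    simp only [map_smul, smul_eq_mul]
    rw [← h5]

theorem integrable_mul_comp_inv_smul_sub {u η : E n → ℝ} (hu : Integrable u (leb Ω))
    {e : E n} {δ : ℝ} (hc : Continuous η) (hη : tsupport η ⊆ Metric.closedBall e δ) (x : E n)
    (t : ℝ) : Integrable (fun y => u y * η (t⁻¹ • (y - x))) (leb Ω) := by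
  obtain ⟨M, -, hM⟩ := exists_abs_le_of_tsupport_subset hc hη
  exact hu.mul_bdd (c := M) (Continuous.aestronglyMeasurable (by fun_prop)) (.of_forall fun y => hM _)

/-- The derivative in `t` of the mollification of `u` at `x` is controlled by `∇u` only. -/
theorem hasDerivAt_integral_mul_rescale {u : E n → ℝ} {g : Fin n → E n → ℝ}
    (hu : Integrable u (leb Ω)) (hug : ∀ i, IsWeakPartial Ω i u (g i))
    {ρ : E n → ℝ} (hρ : ContDiff ℝ ∞ ρ) {e : E n} {δ : ℝ}
    (hρs : tsupport ρ ⊆ Metric.closedBall e δ) {x : E n} {t : ℝ} (ht : 0 < t)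
    (hcone : ∀ w ∈ Metric.closedBall e δ, x + t • w ∈ Ω) :
    HasDerivAt (fun t => ∫ y, u y * rescale ρ x t y ∂(leb Ω))
      (t⁻¹ ^ n * ∑ i, ∫ y, g i y * ((t⁻¹ • (y - x)) i * ρ (t⁻¹ • (y - x))) ∂(leb Ω)) t := by
  have hηc := continuous_radialDiv hρ
  have hηs := (tsupport_radialDiv_subset ρ).trans hρs
  obtain ⟨M, hM0, hM⟩ := exists_abs_le_of_tsupport_subset hηc hηs
  -- Differentiation under the integral is done on scales larger than `t / 2`, where the factor `s⁻¹
  -- ^ (n + 1)` stays bounded.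
  have hder := (hasDerivAt_integral_of_dominated_loc_of_deriv_le (μ := leb Ω)
    (F := fun t y => u y * rescale ρ x t y) (x₀ := t) (s := Set.Ioi (t / 2))
    (F' := fun t y => u y * -(t⁻¹ ^ (n + 1) * radialDiv ρ (t⁻¹ • (y - x))))
    (bound := fun y => |u y| * ((t / 2)⁻¹ ^ (n + 1) * M))
    (Ioi_mem_nhds (by linarith)) ?_ ?_ ?_ ?_ ?_ ?_).2
  · refine hder.congr_deriv (Eq.symm ?_)
    have hφ : ∀ i, ContDiff ℝ ∞ fun w : E n => w i * ρ w := fun i =>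
      (EuclideanSpace.proj i : E n →L[ℝ] ℝ).contDiff.mul hρ
    have hφs : ∀ i, tsupport (fun w : E n => w i * ρ w) ⊆ Metric.closedBall e δ := fun i =>
      (tsupport_mul_subset_right (f := fun w : E n => w i) (g := ρ)).trans hρs
    have hφx : ∀ i, ContDiff ℝ ∞
        fun y : E n => (fun w : E n => w i * ρ w) (t⁻¹ • (y - x)) := fun i =>
      (hφ i).comp ((contDiff_id.sub contDiff_const).const_smul _)
    -- The cone condition makes the rescaled kernels admissible test functions: their supports lie
    -- in `x + t • closedBall e δ`, hence in `Ω`.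
    have hweak := fun i => hug i (fun y => (fun w : E n => w i * ρ w) (t⁻¹ • (y - x)))
      (hφx i) (hasCompactSupport_comp_inv_smul_sub (hφs i) x ht)
      ((tsupport_comp_inv_smul_sub_subset (hφs i) x ht).trans
        (Set.image_subset_iff.2 fun w hw => hcone w hw))
    have hint : ∀ i, Integrable (fun y => u y * fderiv ℝ
        (fun y : E n => (fun w : E n => w i * ρ w) (t⁻¹ • (y - x))) y
        (EuclideanSpace.single i 1)) (leb Ω) := by
      intro i
      have hcd : Continuous fun y => fderiv ℝ
        (fun y : E n => (fun w : E n => w i * ρ w) (t⁻¹ • (y - x))) y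
        (EuclideanSpace.single i 1) :=
        ((hφx i).continuous_fderiv (by simp)).clm_apply continuous_const
      obtain ⟨C, hC⟩ := hcd.bounded_above_of_compact_support
        ((hasCompactSupport_comp_inv_smul_sub (hφs i) x ht).fderiv_apply ℝ _)
      exact hu.mul_bdd (c := C) hcd.aestronglyMeasurable (.of_forall hC)
    calc t⁻¹ ^ n * ∑ i, ∫ y, g i y * ((t⁻¹ • (y - x)) i * ρ (t⁻¹ • (y - x))) ∂(leb Ω)
        = -(t⁻¹ ^ n * ∑ i, ∫ y, u y * fderiv ℝ
            (fun y : E n => (fun w : E n => w i * ρ w) (t⁻¹ • (y - x))) y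
            (EuclideanSpace.single i 1) ∂(leb Ω)) := by
          simp only [hweak, Finset.sum_neg_distrib, mul_neg, neg_neg]
      _ = -(t⁻¹ ^ n * ∫ y, u y * (t⁻¹ * radialDiv ρ (t⁻¹ • (y - x))) ∂(leb Ω)) := by
          rw [← integral_finsetSum _ fun i _ => hint i]
          congr 2
          refine integral_congr_ae (.of_forall fun y => ?_)
          simp only [← Finset.mul_sum]
          rw [← sum_fderiv_coord_mul_rescaled hρ]
      _ = _ := by
          rw [← integral_const_mul, ← integral_neg]
          refine integral_congr_ae (.of_forall fun y => ?_)
          simp only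
          ring
  · refine .of_forall fun s => hu.aestronglyMeasurable.mul (Continuous.aestronglyMeasurable ?_)
    have := hρ.continuous
    unfold rescale
    fun_prop
  · have := (integrable_mul_comp_inv_smul_sub hu hρ.continuous hρs x t).const_mul (t⁻¹ ^ n)
    refine this.congr (.of_forall fun y => ?_)
    simp only [rescale]; ring
  · exact hu.aestronglyMeasurable.mul (Continuous.aestronglyMeasurable (by fun_prop))
  · refine .of_forall fun y s hs => ?_
    have hs' : t / 2 < s := hs
    have hs0 : 0 < s := by linarith
    rw [norm_mul, norm_neg, norm_mul, Real.norm_eq_abs, Real.norm_eq_abs, Real.norm_eq_abs,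
      abs_of_nonneg (show 0 ≤ s⁻¹ ^ (n + 1) by positivity)]
    gcongr
    exact hM _
  · exact hu.abs.mul_const _
  · refine .of_forall fun y s hs => ?_
    have hs' : t / 2 < s := hs
    exact (hasDerivAt_rescale hρ x y (by linarith)).const_mul (u y)

end Mollification

/-! ### Pointwise bound of a Sobolev function by integrals over shrinking balls. -/

section Representation

variable {n : ℕ} {Ω : Set (E n)}

/-- The kernel lives where `‖y - x‖ ≤ (‖e‖ + δ) * s`. The ball is enlarged to scale `t` so that one
ball serves all scales `s ≤ t`. -/
theorem enorm_integral_mul_comp_inv_smul_sub_le (hΩ : MeasurableSet Ω) (f : E n → ℝ)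
    {η : E n → ℝ} {e : E n} {δ M : ℝ} (hηs : tsupport η ⊆ Metric.closedBall e δ)
    (hM : ∀ w, |η w| ≤ M) (x : E n) {s t : ℝ} (hs : 0 < s) (hst : s ≤ t) :
    ‖∫ y, f y * η (s⁻¹ • (y - x)) ∂(leb Ω)‖ₑ ≤
      ENNReal.ofReal M * ballIntegral (Ω.indicator fun y => ‖f y‖ₑ) ((‖e‖ + δ) * t) x := by
  have hpt : ∀ y, ‖f y * η (s⁻¹ • (y - x))‖ₑ ≤
      ENNReal.ofReal M * (Metric.closedBall x ((‖e‖ + δ) * t)).indicator (fun y => ‖f y‖ₑ) y := by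
    intro y
    by_cases hy : y ∈ Metric.closedBall x ((‖e‖ + δ) * t)
    · rw [Set.indicator_of_mem hy, enorm_mul, mul_comm, Real.enorm_eq_ofReal_abs (η _)]
      gcongr
      exact hM _
    · have : η (s⁻¹ • (y - x)) = 0 := by
        by_contra h
        have h1 : s⁻¹ • (y - x) ∈ Metric.closedBall e δ := hηs (subset_tsupport _ h)
        have h2 : ‖s⁻¹ • (y - x)‖ ≤ ‖e‖ + δ := norm_le_of_mem_closedBall h1
        refine hy ?_
        rw [norm_smul, norm_inv, Real.norm_of_nonneg hs.le, inv_mul_le_iff₀ hs] at h2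
        rw [mem_closedBall_iff_norm]
        have h3 : 0 ≤ ‖e‖ + δ := by
          have := (norm_nonneg (y - x)).trans h2
          exact nonneg_of_mul_nonneg_right this hs
        nlinarith
      simp [this]
  calc ‖∫ y, f y * η (s⁻¹ • (y - x)) ∂(leb Ω)‖ₑ
      ≤ ∫⁻ y, ‖f y * η (s⁻¹ • (y - x))‖ₑ ∂(leb Ω) := enorm_integral_le_lintegral_enorm _
    _ ≤ ∫⁻ y, ENNReal.ofReal M *
        (Metric.closedBall x ((‖e‖ + δ) * t)).indicator (fun y => ‖f y‖ₑ) y ∂(leb Ω) :=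
        lintegral_mono hpt
    _ = _ := by
        rw [lintegral_const_mul' _ _ ENNReal.ofReal_ne_top,
          lintegral_indicator Metric.isClosed_closedBall.measurableSet, ballIntegral,
          lintegral_indicator hΩ, Measure.restrict_restrict Metric.isClosed_closedBall.measurableSet,
          Measure.restrict_restrict hΩ, Set.inter_comm]

/-- Mean value inequality on `[s, t]`: the scale derivative is at most `s⁻¹ ^ n * M` times the
integral of `∑ᵢ |gᵢ|` over the ball belonging to the largest scale. -/
theorem enorm_integral_mul_rescale_sub_le (hΩ : MeasurableSet Ω) {u : E n → ℝ}
    {g : Fin n → E n → ℝ} (hu : Integrable u (leb Ω)) (hg : ∀ i, Integrable (g i) (leb Ω))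
    (hgm : ∀ i, Measurable (g i)) (hug : ∀ i, IsWeakPartial Ω i u (g i))
    {ρ : E n → ℝ} (hρ : ContDiff ℝ ∞ ρ) {e : E n} {δ M : ℝ}
    (hρs : tsupport ρ ⊆ Metric.closedBall e δ) (hM : ∀ i w, |w i * ρ w| ≤ M) {x : E n} {h : ℝ}
    (hcone : ∀ t ∈ Set.Ioc 0 h, ∀ w ∈ Metric.closedBall e δ, x + t • w ∈ Ω)
    {s t : ℝ} (hs : 0 < s) (hst : s ≤ t) (hth : t ≤ h) :
    ‖∫ y, u y * rescale ρ x t y ∂(leb Ω) - ∫ y, u y * rescale ρ x s y ∂(leb Ω)‖ₑ ≤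
      ENNReal.ofReal (s⁻¹ ^ n * M * (t - s)) *
        ballIntegral (Ω.indicator fun y => ∑ i, ‖g i y‖ₑ) ((‖e‖ + δ) * t) x := by
  set D := ballIntegral (Ω.indicator fun y => ∑ i, ‖g i y‖ₑ) ((‖e‖ + δ) * t) x with hD
  have hφs : ∀ i, tsupport (fun w : E n => w i * ρ w) ⊆ Metric.closedBall e δ := fun i =>
    (tsupport_mul_subset_right (f := fun w : E n => w i) (g := ρ)).trans hρs
  have hDsum : ∑ i, ballIntegral (Ω.indicator fun y => ‖g i y‖ₑ) ((‖e‖ + δ) * t) x = D := by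
    simp only [hD, ballIntegral]
    rw [← lintegral_finsetSum _ fun i _ => (hgm i).enorm.indicator hΩ]
    refine lintegral_congr fun y => ?_
    by_cases hy : y ∈ Ω <;> simp [hy]
  have hDtop : D ≠ ⊤ := by
    rw [← hDsum]
    refine (ENNReal.sum_lt_top.2 fun i _ => ?_).ne
    refine (setLIntegral_le_lintegral _ _).trans_lt ?_
    rw [lintegral_indicator hΩ]
    exact (hg i).2
  have hbound : ∀ τ ∈ Set.Icc s t,
      ‖τ⁻¹ ^ n * ∑ i, ∫ y, g i y * ((τ⁻¹ • (y - x)) i * ρ (τ⁻¹ • (y - x))) ∂(leb Ω)‖ ≤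
        s⁻¹ ^ n * M * D.toReal := by
    rintro τ ⟨h1, h2⟩
    have hτ : 0 < τ := hs.trans_le h1
    have hsum : ∑ i, ‖∫ y, g i y * ((τ⁻¹ • (y - x)) i * ρ (τ⁻¹ • (y - x))) ∂(leb Ω)‖ₑ ≤
        ENNReal.ofReal M * D := by
      rw [← hDsum, Finset.mul_sum]
      exact Finset.sum_le_sum fun i _ =>
        enorm_integral_mul_comp_inv_smul_sub_le hΩ (g i) (hφs i) (hM i) x hτ h2
    -- In dimension zero `hM` is empty and does not force `0 ≤ M`; both sides vanish there.
    rcases Nat.eq_zero_or_pos n with rfl | hn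
    · simp only [Finset.univ_eq_empty, Finset.sum_empty, mul_zero, norm_zero]
      simp only [D, ballIntegral, Finset.univ_eq_empty, Finset.sum_empty]
      simp
    have hM0 : 0 ≤ M := (abs_nonneg _).trans (hM ⟨0, hn⟩ 0)
    have hsum' : ∑ i, ‖∫ y, g i y * ((τ⁻¹ • (y - x)) i * ρ (τ⁻¹ • (y - x))) ∂(leb Ω)‖ ≤
        M * D.toReal := by
      have := ENNReal.toReal_mono (ENNReal.mul_ne_top ENNReal.ofReal_ne_top hDtop) hsum
      rw [ENNReal.toReal_sum (by simp), ENNReal.toReal_mul, ENNReal.toReal_ofReal hM0] at this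
      simpa using this
    rw [norm_mul, norm_pow, norm_inv, Real.norm_of_nonneg hτ.le, mul_assoc]
    gcongr
    exact (norm_sum_le _ _).trans hsum'
  have hmv := (convex_Icc s t).norm_image_sub_le_of_norm_hasDerivWithin_le
    (f := fun t => ∫ y, u y * rescale ρ x t y ∂(leb Ω))
    (fun τ hτ => (hasDerivAt_integral_mul_rescale hu hug hρ hρs (hs.trans_le hτ.1)
      (hcone τ ⟨hs.trans_le hτ.1, hτ.2.trans hth⟩)).hasDerivWithinAt) hbound
    (Set.left_mem_Icc.2 hst) (Set.right_mem_Icc.2 hst)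
  rw [Real.norm_of_nonneg (sub_nonneg.2 hst)] at hmv
  calc _ = ENNReal.ofReal ‖∫ y, u y * rescale ρ x t y ∂(leb Ω) -
        ∫ y, u y * rescale ρ x s y ∂(leb Ω)‖ := (ofReal_norm _).symm
    _ ≤ ENNReal.ofReal (s⁻¹ ^ n * M * (t - s) * D.toReal) := by
        refine ENNReal.ofReal_le_ofReal (hmv.trans_eq ?_)
        ring
    _ = _ := by
        rw [ENNReal.ofReal_mul' ENNReal.toReal_nonneg, ENNReal.ofReal_toReal hDtop]

theorem integral_rescale {ρ : E n → ℝ} (hρ1 : ∫ w, ρ w = 1) (x : E n) {t : ℝ} (ht : 0 < t) :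
    ∫ y, rescale ρ x t y = 1 := by
  simp only [rescale]
  rw [integral_const_mul, integral_sub_right_eq_self (fun y => ρ (t⁻¹ • y)) x,
    Measure.integral_comp_inv_smul_of_nonneg _ _ ht.le, hρ1, finrank_euclideanSpace_fin,
    smul_eq_mul, mul_one, inv_pow, inv_mul_cancel₀ (pow_pos ht n).ne']

theorem ae_tendsto_integral_mul_rescale (hΩ : MeasurableSet Ω) {u : E n → ℝ}
    (hu : Integrable u (leb Ω)) {ρ : E n → ℝ} (hρ : Continuous ρ) {e : E n} {δ : ℝ} (hδ : 0 < δ)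
    (hρs : tsupport ρ ⊆ Metric.closedBall e δ) (hρ1 : ∫ w, ρ w = 1) :
    ∀ᵐ x, x ∈ Ω → ∀ t : ℕ → ℝ, Tendsto t atTop (𝓝[>] 0) →
      Tendsto (fun k => ∫ y, u y * rescale ρ x (t k) y ∂(leb Ω)) atTop (𝓝 (u x)) := by
  have hf : Integrable (Ω.indicator u) volume := (integrable_indicator_iff hΩ).2 hu
  obtain ⟨M, hM0, hM⟩ := exists_abs_le_of_tsupport_subset hρ hρs
  -- The kernel is centred at `x + t • e`, not at `x`. Lebesgue differentiation is therefore used in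
  -- its off-centre form: `x` lies in the ball about that centre with radius `‖e‖ / δ` times `t *
  -- δ`.
  filter_upwards [IsUnifLocDoublingMeasure.ae_tendsto_average_norm_sub volume
    hf.locallyIntegrable (‖e‖ / δ)] with x hx hxΩ t ht
  have ht0 : ∀ᶠ k in atTop, 0 < t k := ht.eventually self_mem_nhdsWithin
  have htδ : Tendsto (fun k => t k * δ) atTop (𝓝[>] 0) := by
    refine tendsto_nhdsWithin_iff.2 ⟨?_, ?_⟩
    · simpa using (tendsto_nhds_of_tendsto_nhdsWithin ht).mul_const δ
    · filter_upwards [ht0] with k hk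
      exact mul_pos hk hδ
  have hav := hx (fun k => x + t k • e) (fun k => t k * δ) htδ (by
    filter_upwards [ht0] with k hk
    rw [mem_closedBall_iff_norm]
    simp only [sub_add_cancel_left, norm_neg, norm_smul, Real.norm_of_nonneg hk.le]
    rw [div_mul_eq_mul_div, mul_comm (t k) δ, ← mul_assoc, mul_right_comm,
      mul_div_cancel_right₀ _ hδ.ne', mul_comm])
  rw [tendsto_iff_norm_sub_tendsto_zero]
  have hlim := hav.const_mul (M * (δ ^ n * volume.real (Metric.ball (0 : E n) 1)))
  rw [mul_zero] at hlim
  refine squeeze_zero' (.of_forall fun k => norm_nonneg _) ?_ hlim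
  filter_upwards [ht0] with k hk
  set S := Metric.closedBall (x + t k • e) (t k * δ) with hS
  have hcr : Continuous (rescale ρ x (t k)) := by unfold rescale; fun_prop
  have hrsupp : ∀ y, y ∉ S → rescale ρ x (t k) y = 0 := by
    intro y hy
    have : ρ ((t k)⁻¹ • (y - x)) = 0 := by
      by_contra h
      refine hy ?_
      have h1 := hρs (subset_tsupport _ h)
      rw [mem_closedBall_iff_norm] at h1 ⊢
      have h2 : y - (x + t k • e) = t k • ((t k)⁻¹ • (y - x) - e) := by
        rw [smul_sub, smul_smul, mul_inv_cancel₀ hk.ne', one_smul]; abel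
      rw [h2, norm_smul, Real.norm_of_nonneg hk.le]
      gcongr
    simp [rescale, this]
  have hrbound : ∀ y, |rescale ρ x (t k) y| ≤ (t k)⁻¹ ^ n * M := by
    intro y
    rw [rescale, abs_mul, abs_of_nonneg (show 0 ≤ (t k)⁻¹ ^ n by positivity)]
    gcongr
    exact hM _
  have hri : Integrable (rescale ρ x (t k)) volume :=
    hcr.integrable_of_hasCompactSupport
      (HasCompactSupport.intro (isCompact_closedBall _ _) fun y hy => hrsupp y hy)
  have hfr : Integrable (fun y => Ω.indicator u y * rescale ρ x (t k) y) volume :=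
    hf.mul_bdd (c := (t k)⁻¹ ^ n * M) hcr.aestronglyMeasurable (.of_forall hrbound)
  have h1 : ∫ y, u y * rescale ρ x (t k) y ∂(leb Ω) =
      ∫ y, Ω.indicator u y * rescale ρ x (t k) y := by
    rw [← integral_indicator hΩ]
    refine integral_congr_ae (.of_forall fun y => ?_)
    by_cases hy : y ∈ Ω <;> simp [hy]
  have h2 : ∫ y, u y * rescale ρ x (t k) y ∂(leb Ω) - u x =
      ∫ y, (Ω.indicator u y - Ω.indicator u x) * rescale ρ x (t k) y := by
    simp only [sub_mul]
    rw [integral_sub hfr (hri.const_mul _), integral_const_mul, integral_rescale hρ1 x hk, h1,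
      mul_one, Set.indicator_of_mem hxΩ]
  have hfx : IntegrableOn (fun y => ‖Ω.indicator u y - Ω.indicator u x‖) S volume :=
    (hf.integrableOn.sub (integrableOn_const (isCompact_closedBall _ _).measure_lt_top.ne)).norm
  rw [h2]
  calc ‖∫ y, (Ω.indicator u y - Ω.indicator u x) * rescale ρ x (t k) y‖
      = ‖∫ y in S, (Ω.indicator u y - Ω.indicator u x) * rescale ρ x (t k) y‖ := by
        rw [setIntegral_eq_integral_of_forall_compl_eq_zero]
        intro y hy
        rw [hrsupp y hy, mul_zero]
    _ ≤ ∫ y in S, ‖Ω.indicator u y - Ω.indicator u x‖ * ((t k)⁻¹ ^ n * M) := by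
        refine norm_integral_le_of_norm_le (hfx.mul_const _) (.of_forall fun y => ?_)
        rw [norm_mul]
        gcongr
        exact hrbound y
    _ = _ := by
        have hv : volume.real S = (t k * δ) ^ n * volume.real (Metric.ball (0 : E n) 1) := by
          rw [hS, Measure.addHaar_real_closedBall _ _ (by positivity), finrank_euclideanSpace_fin]
        have hb : 0 < volume.real (Metric.ball (0 : E n) 1) :=
          ENNReal.toReal_pos (Metric.measure_ball_pos _ _ one_pos).ne' measure_ball_lt_top.ne
        rw [integral_mul_const, setAverage_eq, hv, smul_eq_mul, mul_pow, inv_pow]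
        field_simp

/-- Pointwise bound of a Sobolev function on a set satisfying a uniform interior cone condition. -/
theorem ae_enorm_le_ballIntegral (hΩ : MeasurableSet Ω) {e : E n} {δ h : ℝ} (hδ : 0 < δ)
    (hh : 0 < h) : ∃ M : ℝ, 0 ≤ M ∧ ∀ (u : E n → ℝ) (g : Fin n → E n → ℝ),
    Integrable u (leb Ω) → (∀ i, Integrable (g i) (leb Ω)) → (∀ i, Measurable (g i)) →
    (∀ i, IsWeakPartial Ω i u (g i)) → ∀ᵐ x, x ∈ Ω →
    (∀ t ∈ Set.Ioc 0 h, ∀ w ∈ Metric.closedBall e δ, x + t • w ∈ Ω) →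
    ‖u x‖ₑ ≤ ENNReal.ofReal (h⁻¹ ^ n * M) *
        ballIntegral (Ω.indicator fun y => ‖u y‖ₑ) ((‖e‖ + δ) * h) x +
      ∑' k : ℕ, ENNReal.ofReal ((h / 2 ^ (k + 1))⁻¹ ^ n * M * (h / 2 ^ (k + 1))) *
        ballIntegral (Ω.indicator fun y => ∑ i, ‖g i y‖ₑ) ((‖e‖ + δ) * (h / 2 ^ k)) x := by
  let bump : ContDiffBump e := ⟨δ / 2, δ, by linarith, by linarith⟩
  set ρ : E n → ℝ := bump.normed volume
  have hρ : ContDiff ℝ ∞ ρ := bump.contDiff_normed (n := ⊤)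
  have hρs : tsupport ρ ⊆ Metric.closedBall e δ := (bump.tsupport_normed_eq).subset
  have hρ1 : ∫ w, ρ w = 1 := bump.integral_normed
  obtain ⟨M₀, hM₀, hMρ⟩ := exists_abs_le_of_tsupport_subset hρ.continuous hρs
  have hR : 0 ≤ ‖e‖ + δ := by positivity
  have hM₁ : ∀ i w, |w i * ρ w| ≤ (‖e‖ + δ) * M₀ := by
    intro i w
    by_cases hw : w ∈ Metric.closedBall e δ
    · rw [abs_mul]
      gcongr
      · exact (PiLp.norm_apply_le w i).trans (norm_le_of_mem_closedBall hw)
      · exact hMρ w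
    · rw [image_eq_zero_of_notMem_tsupport fun h' => hw (hρs h')]
      simp only [mul_zero, abs_zero]
      positivity
  -- One constant for both kernels: `ρ` in the term at the largest scale, and `wᵢ ρ` in the
  -- increments between scales.
  set M := max M₀ ((‖e‖ + δ) * M₀)
  refine ⟨M, hM₀.trans (le_max_left _ _), fun u g hu hg hgm hug => ?_⟩
  filter_upwards [ae_tendsto_integral_mul_rescale hΩ hu hρ.continuous hδ hρs hρ1]
    with x hx hxΩ hcone
  -- With dyadic scales, `u x` is the limit of the averages `G k`, hence bounded by `G 0` plus the
  -- sum of the increments.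
  set t : ℕ → ℝ := fun k => h / 2 ^ k with ht
  have ht0 : ∀ k, 0 < t k := fun k => by positivity
  have hth : ∀ k, t k ≤ h := fun k => div_le_self hh.le (one_le_pow₀ one_le_two)
  have htt : ∀ k, t k - t (k + 1) = t (k + 1) := fun k => by
    simp only [ht, pow_succ]; field_simp; norm_num
  have htlim : Tendsto t atTop (𝓝[>] 0) := by
    refine tendsto_nhdsWithin_iff.2 ⟨?_, .of_forall fun k => ht0 k⟩
    have := (tendsto_pow_atTop_nhds_zero_of_lt_one (r := (1 / 2 : ℝ)) (by norm_num)
      (by norm_num)).const_mul h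
    simp only [mul_zero] at this
    refine this.congr fun k => ?_
    rw [ht, div_pow, one_pow, mul_one_div]
  set G : ℕ → ℝ := fun k => ∫ y, u y * rescale ρ x (t k) y ∂(leb Ω)
  have hG0 : ‖G 0‖ₑ ≤ ENNReal.ofReal (h⁻¹ ^ n * M) *
        ballIntegral (Ω.indicator fun y => ‖u y‖ₑ) ((‖e‖ + δ) * h) x := by
    have h1 : G 0 = h⁻¹ ^ n * ∫ y, u y * ρ (h⁻¹ • (y - x)) ∂(leb Ω) := by
      rw [← integral_const_mul]
      refine integral_congr_ae (.of_forall fun y => ?_)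
      simp only [rescale, ht, pow_zero, div_one]; ring
    rw [h1, enorm_mul, Real.enorm_eq_ofReal (by positivity), ENNReal.ofReal_mul (by positivity),
      mul_assoc]
    gcongr
    exact enorm_integral_mul_comp_inv_smul_sub_le hΩ u hρs
      (fun w => (hMρ w).trans (le_max_left _ _)) x hh le_rfl
  have hstep : ∀ k, ‖G (k + 1) - G k‖ₑ ≤ ENNReal.ofReal ((t (k + 1))⁻¹ ^ n * M * t (k + 1)) *
        ballIntegral (Ω.indicator fun y => ∑ i, ‖g i y‖ₑ) ((‖e‖ + δ) * t k) x := by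
    intro k
    rw [← enorm_neg, neg_sub]
    have := enorm_integral_mul_rescale_sub_le hΩ hu hg hgm hug hρ hρs
      (fun i w => (hM₁ i w).trans (le_max_right M₀ _)) hcone (ht0 (k + 1))
      (by have := htt k; have := ht0 (k + 1); linarith) (hth k)
    rwa [htt k] at this
  have hsum : ∀ k, ‖G k‖ₑ ≤ ‖G 0‖ₑ + ∑ j ∈ Finset.range k, ‖G (j + 1) - G j‖ₑ := by
    intro k
    have : G k = G 0 + ∑ j ∈ Finset.range k, (G (j + 1) - G j) := by
      rw [Finset.sum_range_sub]; ring
    rw [this]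
    refine (enorm_add_le _ _).trans ?_
    gcongr
    exact enorm_sum_le _ _
  refine le_of_tendsto ((continuous_enorm.tendsto _).comp (hx hxΩ t htlim))
    (.of_forall fun k => (hsum k).trans (add_le_add hG0 ?_))
  exact (Finset.sum_le_sum fun j _ => hstep j).trans (ENNReal.sum_le_tsum _)

end Representation

/-! ### The subcritical Sobolev embedding on a `C^{1,1}` domain. -/

section Embedding

variable {n : ℕ} {Ω : Set (E n)}

theorem eLpNorm'_indicator_enorm {α : Type*} [MeasurableSpace α] {μ : Measure α} {s : Set α}
    (hs : MeasurableSet s) (F : α → ℝ≥0∞) {q : ℝ} (hq : 0 < q) :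
    eLpNorm' (s.indicator F) q μ = eLpNorm' F q (μ.restrict s) := by
  simp only [eLpNorm', enorm_eq_self]
  rw [← lintegral_indicator hs]
  congr 2
  funext x
  by_cases hx : x ∈ s <;> simp [hx, hq]

/-- With `t = h / 2 ^ k`, the weight is of order `t ^ (1 - n)` and the volume factor of order `t ^
(n * (1 / 2 + 1 / q))`. The series is geometric with ratio `2 ^ (n * (1 / 2 - 1 / q) - 1)`, which is
below `1` exactly in the subcritical range. -/
theorem tsum_geometric_ballIntegral_ne_top {q : ℝ} (hqn : (n : ℝ) * (1 / 2 - 1 / q) < 1)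
    (hq : 0 < q) {h M R : ℝ} (hh : 0 < h) (hM : 0 ≤ M) (hR : 0 ≤ R) :
    ∑' k : ℕ, ENNReal.ofReal ((h / 2 ^ (k + 1))⁻¹ ^ n * M * (h / 2 ^ (k + 1))) *
      volume (Metric.closedBall (0 : E n) (R * (h / 2 ^ k))) ^ (1 / 2 + 1 / q) ≠ ⊤ := by
  set σ := 1 / 2 + 1 / q with hσ
  have hσ0 : 0 ≤ σ := by positivity
  set θ : ℝ := 2 ^ n / 2 * (((1 / 2 : ℝ) ^ n) ^ σ) with hθ
  have hθ0 : 0 ≤ θ := by positivity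
  have hθ1 : θ < 1 := by
    have h1 : θ = (2 : ℝ) ^ ((n : ℝ) - 1 - n * σ) := by
      rw [Real.rpow_sub two_pos, Real.rpow_sub two_pos, Real.rpow_one, Real.rpow_natCast, hθ,
        Real.rpow_mul two_pos.le, Real.rpow_natCast, one_div, inv_pow,
        Real.inv_rpow (by positivity), div_eq_mul_inv]
      rfl
    rw [h1]
    refine Real.rpow_lt_one_of_one_lt_of_neg one_lt_two ?_
    have : (n : ℝ) - 1 - n * σ = (n : ℝ) * (1 / 2 - 1 / q) - 1 := by rw [hσ]; ring
    linarith
  have hterm : ∀ k : ℕ, ENNReal.ofReal ((h / 2 ^ (k + 1))⁻¹ ^ n * M * (h / 2 ^ (k + 1))) *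
      volume (Metric.closedBall (0 : E n) (R * (h / 2 ^ k))) ^ σ =
      ENNReal.ofReal ((h / 2)⁻¹ ^ n * M * (h / 2) * ((R * h) ^ n) ^ σ) *
        volume (Metric.ball (0 : E n) 1) ^ σ * ENNReal.ofReal θ ^ k := by
    intro k
    have e1 : (h / 2 ^ (k + 1))⁻¹ ^ n * M * (h / 2 ^ (k + 1)) =
        (h / 2)⁻¹ ^ n * M * (h / 2) * (2 ^ n / 2) ^ k := by
      have : h / 2 ^ (k + 1) = h / 2 * (2 ^ k)⁻¹ := by rw [pow_succ]; field_simp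
      rw [this, mul_inv, mul_pow, inv_inv, div_pow, ← pow_mul, ← pow_mul, mul_comm n k]
      field_simp
    have e2 : ((R * (h / 2 ^ k)) ^ n) ^ σ = ((R * h) ^ n) ^ σ * (((1 / 2 : ℝ) ^ n) ^ σ) ^ k := by
      have : (R * (h / 2 ^ k)) ^ n = (R * h) ^ n * ((1 / 2 : ℝ) ^ n) ^ k := by
        rw [← pow_mul, mul_comm n k, pow_mul, ← mul_pow]
        congr 1
        rw [one_div, inv_pow]
        field_simp
      rw [this, Real.mul_rpow (by positivity) (by positivity), Real.rpow_pow_comm (by positivity)]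
    rw [Measure.addHaar_closedBall _ _ (by positivity), finrank_euclideanSpace_fin,
      ENNReal.mul_rpow_of_nonneg _ _ hσ0, ENNReal.ofReal_rpow_of_nonneg (by positivity) hσ0,
      ← mul_assoc, ← ENNReal.ofReal_mul (by positivity), e1, e2, ← ENNReal.ofReal_pow hθ0, hθ,
      mul_right_comm (ENNReal.ofReal ((h / 2)⁻¹ ^ n * M * (h / 2) * ((R * h) ^ n) ^ σ)),
      ← ENNReal.ofReal_mul (by positivity)]
    congr 2
    rw [mul_pow]
    ring
  simp only [hterm]
  rw [ENNReal.tsum_mul_left, ENNReal.tsum_geometric]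
  refine ENNReal.mul_ne_top (ENNReal.mul_ne_top ENNReal.ofReal_ne_top
    (ENNReal.rpow_ne_top_of_nonneg hσ0 measure_ball_lt_top.ne)) (ENNReal.inv_ne_top.2 ?_)
  exact (tsub_pos_of_lt (by rwa [ENNReal.ofReal_lt_one])).ne'

/-- `L^q(Ω ∩ S)` is controlled by `H¹(Ω)`. -/
def LocalSobolevBound (Ω : Set (E n)) (q : ℝ) (S : Set (E n)) : Prop :=
  ∃ C : ℝ≥0∞, C ≠ ⊤ ∧ ∀ (u : E n → ℝ) (g : Fin n → E n → ℝ), Measurable u →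
    (∀ i, Measurable (g i)) → Integrable u (leb Ω) → (∀ i, Integrable (g i) (leb Ω)) →
    (∀ i, IsWeakPartial Ω i u (g i)) →
    eLpNorm' u q (volume.restrict (Ω ∩ S)) ≤
      C * (eLpNorm' u 2 (leb Ω) + ∑ i, eLpNorm' (g i) 2 (leb Ω))

/-- The `L^q` norm of the pointwise bound is taken term by term, with the `L² → L^q` estimate on
each ball. The right side involves all of `Ω` because cones with apex in `S` may leave `S`. -/
theorem localSobolevBound_of_cone (hΩ : MeasurableSet Ω) {q : ℝ} (hq : 2 ≤ q)
    (hqn : (n : ℝ) * (1 / 2 - 1 / q) < 1) {e : E n} {δ h : ℝ} (hδ : 0 < δ) (hh : 0 < h)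
    {S : Set (E n)} (hS : MeasurableSet S)
    (hcone : ∀ x ∈ Ω ∩ S, ∀ t ∈ Set.Ioc 0 h, ∀ w ∈ Metric.closedBall e δ, x + t • w ∈ Ω) :
    LocalSobolevBound Ω q S := by
  have hq0 : 0 < q := by linarith
  obtain ⟨M, hM0, hM⟩ := ae_enorm_le_ballIntegral hΩ (e := e) hδ hh
  have hR : 0 ≤ ‖e‖ + δ := by positivity
  set σ := 1 / 2 + 1 / q with hσ
  set C₀ := ENNReal.ofReal (h⁻¹ ^ n * M) *
    volume (Metric.closedBall (0 : E n) ((‖e‖ + δ) * h)) ^ σ with hC₀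
  have hC₀t : C₀ ≠ ⊤ := ENNReal.mul_ne_top ENNReal.ofReal_ne_top
    (ENNReal.rpow_ne_top_of_nonneg (by positivity) measure_closedBall_lt_top.ne)
  set C₁ := ∑' k : ℕ, ENNReal.ofReal ((h / 2 ^ (k + 1))⁻¹ ^ n * M * (h / 2 ^ (k + 1))) *
      volume (Metric.closedBall (0 : E n) ((‖e‖ + δ) * (h / 2 ^ k))) ^ σ with hC₁
  have hC₁t : C₁ ≠ ⊤ := tsum_geometric_ballIntegral_ne_top hqn hq0 hh hM0 hR
  refine ⟨C₀ + C₁, ENNReal.add_ne_top.2 ⟨hC₀t, hC₁t⟩, fun u g hum hgm hu hg hug => ?_⟩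
  set U : E n → ℝ≥0∞ := Ω.indicator fun y => ‖u y‖ₑ with hU
  set G : E n → ℝ≥0∞ := Ω.indicator fun y => ∑ i, ‖g i y‖ₑ with hG
  have hUm : Measurable U := hum.enorm.indicator hΩ
  have hGm : Measurable G := (Finset.measurable_fun_sum _ fun i _ => (hgm i).enorm).indicator hΩ
  have hUn : eLpNorm' U 2 volume = eLpNorm' u 2 (leb Ω) := by
    rw [hU, eLpNorm'_indicator_enorm hΩ _ two_pos, eLpNorm'_enorm]
  have hGn : eLpNorm' G 2 volume ≤ ∑ i, eLpNorm' (g i) 2 (leb Ω) := by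
    rw [hG, eLpNorm'_indicator_enorm hΩ _ two_pos]
    have := eLpNorm'_sum_le (μ := leb Ω) (f := fun i y => ‖g i y‖ₑ) (s := Finset.univ) (q := 2)
      (fun i _ => (hgm i).enorm.aestronglyMeasurable) one_le_two
    simp only [eLpNorm'_enorm] at this
    rwa [show ∑ i, (fun y => ‖g i y‖ₑ) = fun y => ∑ i, ‖g i y‖ₑ by funext y; simp] at this
  set a : E n → ℝ≥0∞ := fun x => ENNReal.ofReal (h⁻¹ ^ n * M) *
    ballIntegral U ((‖e‖ + δ) * h) x with ha
  set b : ℕ → E n → ℝ≥0∞ := fun k x =>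
    ENNReal.ofReal ((h / 2 ^ (k + 1))⁻¹ ^ n * M * (h / 2 ^ (k + 1))) *
      ballIntegral G ((‖e‖ + δ) * (h / 2 ^ k)) x with hb
  have ham : Measurable a := (measurable_ballIntegral hUm _).const_mul _
  have hbm : ∀ k, Measurable (b k) := fun k => (measurable_ballIntegral hGm _).const_mul _
  have hmul : ∀ (c : ℝ≥0∞) (F : E n → ℝ≥0∞), c ≠ ⊤ →
      eLpNorm' (fun x => c * F x) q volume = c * eLpNorm' F q volume := by
    intro c F hc
    simp only [eLpNorm', enorm_eq_self, ENNReal.mul_rpow_of_nonneg _ _ hq0.le]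
    rw [lintegral_const_mul' _ _ (ENNReal.rpow_ne_top_of_nonneg hq0.le hc),
      ENNReal.mul_rpow_of_nonneg _ _ (by positivity), ← ENNReal.rpow_mul,
      mul_one_div_cancel hq0.ne', ENNReal.rpow_one]
  have han : eLpNorm' a q volume ≤ C₀ * eLpNorm' u 2 (leb Ω) := by
    rw [ha, hmul _ _ ENNReal.ofReal_ne_top, hC₀, mul_assoc, ← hUn]
    gcongr
    exact eLpNorm'_ballIntegral_le hUm _ hq
  have hbn : eLpNorm' (fun x => ∑' k, b k x) q volume ≤
      C₁ * ∑ i, eLpNorm' (g i) 2 (leb Ω) := by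
    refine (eLpNorm'_tsum_le hbm (by linarith)).trans ?_
    rw [hC₁, ← ENNReal.tsum_mul_right]
    refine ENNReal.tsum_le_tsum fun k => ?_
    rw [hb, hmul _ _ ENNReal.ofReal_ne_top, mul_assoc (ENNReal.ofReal _)]
    gcongr
    exact (eLpNorm'_ballIntegral_le hGm _ hq).trans (by gcongr)
  have hpt : ∀ᵐ x ∂(volume.restrict (Ω ∩ S)), ‖u x‖ₑ ≤ ‖a x + ∑' k, b k x‖ₑ := by
    filter_upwards [ae_restrict_of_ae (hM u g hu hg hgm hug), ae_restrict_mem (hΩ.inter hS)]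
      with x hx hxS
    exact hx hxS.1 (hcone x hxS)
  calc eLpNorm' u q (volume.restrict (Ω ∩ S))
      ≤ eLpNorm' (fun x => a x + ∑' k, b k x) q (volume.restrict (Ω ∩ S)) :=
        eLpNorm'_mono_enorm_ae hq0.le hpt
    _ ≤ eLpNorm' (fun x => a x + ∑' k, b k x) q volume :=
        eLpNorm'_mono_measure _ Measure.restrict_le_self hq0.le
    _ ≤ eLpNorm' a q volume + eLpNorm' (fun x => ∑' k, b k x) q volume :=
        eLpNorm'_add_le ham.aestronglyMeasurable
          (Measurable.tsum hbm).aestronglyMeasurable (by linarith)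
    _ ≤ C₀ * eLpNorm' u 2 (leb Ω) + C₁ * ∑ i, eLpNorm' (g i) 2 (leb Ω) := add_le_add han hbn
    _ ≤ _ := by
        rw [mul_add]
        gcongr
        · exact le_self_add
        · exact le_add_self

/-- Every point of the closure of a `C^{1,1}` domain has a neighbourhood in which the domain
satisfies a uniform interior cone condition. -/
theorem IsBoundedC11Domain.exists_cone (hΩ : IsBoundedC11Domain Ω) {x₀ : E n}
    (hx₀ : x₀ ∈ closure Ω) : ∃ (e : E n) (r δ h : ℝ), 0 < r ∧ 0 < δ ∧ 0 < h ∧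
      ∀ x ∈ Ω ∩ Metric.ball x₀ r, ∀ t ∈ Set.Ioc 0 h, ∀ w ∈ Metric.closedBall e δ,
        x + t • w ∈ Ω := by
  by_cases hx : x₀ ∈ Ω
  · obtain ⟨r, hr, hball⟩ := Metric.isOpen_iff.1 hΩ.isOpen x₀ hx
    -- At an interior point no direction is needed: axis `0` turns the cone into a ball around its
    -- apex.
    refine ⟨0, r / 2, 1, r / 2, by linarith, one_pos, by linarith, ?_⟩
    rintro x ⟨-, hxr⟩ t ⟨ht0, ht⟩ w hw
    refine hball ?_
    rw [mem_ball_iff_norm] at hxr ⊢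
    rw [mem_closedBall_zero_iff] at hw
    calc ‖x + t • w - x₀‖ = ‖(x - x₀) + t • w‖ := by congr 1; abel
      _ ≤ ‖x - x₀‖ + ‖t • w‖ := norm_add_le _ _
      _ = ‖x - x₀‖ + t * ‖w‖ := by rw [norm_smul, Real.norm_of_nonneg ht0.le]
      _ < r := by nlinarith
  obtain ⟨e, he, r, hr, φ, hφ, -, hiff⟩ := hΩ.boundary x₀
    (by rw [hΩ.isOpen.frontier_eq]; exact ⟨hx₀, hx⟩)
  let π : E n → E n := fun x => x - (inner ℝ e x : ℝ) • e
  have hπadd : ∀ x y, π (x + y) = π x + π y := fun x y => by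
    simp only [π, inner_add_right, add_smul]; abel
  have hπsub : ∀ x y, π (x - y) = π x - π y := fun x y => by
    simp only [π, inner_sub_right, sub_smul]; abel
  have hπsmul : ∀ (t : ℝ) x, π (t • x) = t • π x := fun t x => by
    simp only [π, inner_smul_right, smul_sub, mul_smul]
  have hπe : π e = 0 := by simp [π, he]
  have hπn : ∀ x, ‖π x‖ ≤ 2 * ‖x‖ := fun x => by
    have h1 : ‖(inner ℝ e x : ℝ) • e‖ ≤ ‖x‖ := by
      rw [norm_smul, he, mul_one]
      simpa [he] using norm_inner_le_norm (𝕜 := ℝ) e x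
    have := norm_sub_le x ((inner ℝ e x : ℝ) • e)
    simp only [π]
    linarith
  obtain ⟨K, s, hs, hK⟩ := (hφ.contDiffAt (x := π x₀)).exists_lipschitzOnWith
  obtain ⟨r', hr', hball⟩ := Metric.mem_nhds_iff.1 hs
  set m := min r r'
  have hm : 0 < m := lt_min hr hr'
  have hmr : m ≤ r := min_le_left _ _
  have hmr' : m ≤ r' := min_le_right _ _
  -- Chosen so that `2 * K * δ = 1 - δ`. Moving by `t • w` gains at least `t * (1 - δ)` in height
  -- and shifts the projection by at most `2 * δ * t`, so `φ` rises by no more than the gain.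
  -- Strictness is inherited from `x ∈ Ω`.
  set δ : ℝ := 1 / (2 * K + 1) with hδ
  have hδ0 : 0 < δ := by positivity
  have hδK : δ * (2 * K + 1) = 1 := by rw [hδ]; field_simp
  have hδ1 : δ ≤ 1 := by
    rw [hδ, div_le_one (by positivity)]
    have := K.2
    have : (0 : ℝ) ≤ K := K.2
    linarith
  -- Since `‖w‖ ≤ 2`, all points stay within `m / 4` of `x₀`, and their projections within `m / 2`
  -- of `π x₀`, as `π` is only bounded by a factor `2` here.
  refine ⟨e, m / 8, δ, m / 16, by linarith, hδ0, by linarith, ?_⟩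
  rintro x ⟨hxΩ, hxr⟩ t ⟨ht0, ht⟩ w hw
  rw [mem_ball_iff_norm] at hxr
  rw [mem_closedBall_iff_norm] at hw
  have hwn : ‖w‖ ≤ 2 := by
    have := norm_le_insert' w e
    linarith
  have htw : ‖t • w‖ ≤ m / 8 := by
    rw [norm_smul, Real.norm_of_nonneg ht0.le]
    nlinarith [norm_nonneg w]
  have hdist : ‖x + t • w - x₀‖ ≤ m / 4 := by
    have : x + t • w - x₀ = (x - x₀) + t • w := by abel
    rw [this]
    have := norm_add_le (x - x₀) (t • w)
    linarith
  have hmem : ∀ y, ‖y - x₀‖ ≤ m / 4 → π y ∈ s := by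
    intro y hy
    refine hball ?_
    rw [mem_ball_iff_norm, ← hπsub]
    have := hπn (y - x₀)
    linarith
  rw [hiff _ (by rw [mem_ball_iff_norm]; linarith)]
  have hxin := (hiff x (by rw [mem_ball_iff_norm]; linarith)).1 hxΩ
  have hlip := hK.dist_le_mul _ (hmem _ hdist) _ (hmem x (by linarith))
  rw [Real.dist_eq, dist_eq_norm, hπadd, add_sub_cancel_left, hπsmul, norm_smul,
    Real.norm_of_nonneg ht0.le, ← hπsmul, ← hπadd] at hlip
  have hπw : ‖π w‖ ≤ 2 * δ := by
    have h1 : π w = π (w - e) := by rw [hπsub, hπe, sub_zero]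
    rw [h1]
    have := hπn (w - e)
    linarith
  have hin : t * (1 - δ) ≤ inner ℝ e (t • w) := by
    have h1 : inner ℝ e w = 1 + inner ℝ e (w - e) := by
      rw [inner_sub_right, real_inner_self_eq_norm_sq, he]; ring
    have h2 : |inner ℝ e (w - e)| ≤ δ := by
      have := abs_real_inner_le_norm e (w - e)
      rw [he, one_mul] at this
      linarith
    rw [inner_smul_right, h1]
    have := (abs_le.1 h2).1
    nlinarith
  have h3 : φ (π (x + t • w)) ≤ φ (π x) + K * (t * (2 * δ)) := by
    have h4 : (K : ℝ) * (t * ‖π w‖) ≤ K * (t * (2 * δ)) := by gcongr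
    have := (abs_le.1 hlip).2
    linarith
  have h5 : (K : ℝ) * (t * (2 * δ)) = t * (1 - δ) := by
    have : 2 * K * δ = 1 - δ := by linarith
    rw [← this]; ring
  change φ (π (x + t • w)) < inner ℝ e (x + t • w)
  have h6 : φ (π x) < inner ℝ e x := hxin
  rw [inner_add_right]
  linarith

/-- The subcritical Sobolev embedding `H¹(Ω) ⊆ L^q(Ω)`. -/
theorem IsBoundedC11Domain.localSobolevBound_univ (hΩ : IsBoundedC11Domain Ω) {q : ℝ}
    (hq : 2 ≤ q) (hqn : (n : ℝ) * (1 / 2 - 1 / q) < 1) : LocalSobolevBound Ω q Set.univ := by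
  have hq0 : 0 < q := by linarith
  have hcl : LocalSobolevBound Ω q (closure Ω) := by
    refine hΩ.isBounded.isCompact_closure.induction_on (p := LocalSobolevBound Ω q) ?_ ?_ ?_ ?_
    · refine ⟨0, by simp, fun u g _ _ _ _ _ => ?_⟩
      simp [eLpNorm', hq0]
    · rintro s t hst ⟨C, hC, h⟩
      refine ⟨C, hC, fun u g h1 h2 h3 h4 h5 => le_trans ?_ (h u g h1 h2 h3 h4 h5)⟩
      exact eLpNorm'_mono_measure _
        (Measure.restrict_mono (Set.inter_subset_inter_right _ hst) le_rfl) hq0.le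
    · rintro s t ⟨C, hC, h⟩ ⟨C', hC', h'⟩
      refine ⟨C + C', ENNReal.add_ne_top.2 ⟨hC, hC'⟩, fun u g h1 h2 h3 h4 h5 => ?_⟩
      rw [add_mul, Set.inter_union_distrib_left]
      refine le_trans ?_ (add_le_add (h u g h1 h2 h3 h4 h5) (h' u g h1 h2 h3 h4 h5))
      simp only [eLpNorm']
      -- The power `1 / q` is subadditive because `q ≥ 1`.
      refine le_trans ?_ (ENNReal.rpow_add_le_add_rpow _ _ (by positivity)
        ((div_le_one hq0).2 (by linarith)))
      gcongr
      exact lintegral_union_le _ _ _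
    · intro x hx
      obtain ⟨e, r, δ, h, hr, hδ, hh, hcone⟩ := hΩ.exists_cone hx
      exact ⟨Metric.ball x r, mem_nhdsWithin_of_mem_nhds (Metric.ball_mem_nhds x hr),
        localSobolevBound_of_cone hΩ.isOpen.measurableSet hq hqn hδ hh
          Metric.isOpen_ball.measurableSet hcone⟩
  obtain ⟨C, hC, h⟩ := hcl
  refine ⟨C, hC, fun u g h1 h2 h3 h4 h5 => ?_⟩
  have := h u g h1 h2 h3 h4 h5
  rw [Set.inter_eq_left.2 subset_closure] at this
  rwa [Set.inter_univ]

end Embedding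

/-! ### Integrability of `u` and `∇u` beyond `L²`. -/

section Jet

variable {n : ℕ} {Ω : Set (E n)}

/-- The `1`-jet of `u`: the label `none` stands for `u`, the label `some i` for `∂ᵢ u`. -/
noncomputable def H2.jet (u : H2 Ω) : Option (Fin n) → Lp ℝ 2 (leb Ω)
  | none => u.fn
  | some i => u.partialDeriv i

theorem H2.jet_add (u v : H2 Ω) (o : Option (Fin n)) : (u + v).jet o = u.jet o + v.jet o := by
  cases o <;> rfl

theorem H2.jet_smul (t : ℝ) (u : H2 Ω) (o : Option (Fin n)) : (t • u).jet o = t • u.jet o := by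
  cases o <;> rfl

/-- The pointwise `ℓ¹`-norm `|u| + ∑ᵢ |∂ᵢ u|` of the `1`-jet. -/
noncomputable def H2.jetNorm (u : H2 Ω) (x : E n) : ℝ := ∑ o, |u.jet o x|

theorem H2.jetNorm_nonneg (u : H2 Ω) (x : E n) : 0 ≤ u.jetNorm x :=
  Finset.sum_nonneg fun _ _ => abs_nonneg _

theorem H2.measurable_jetNorm (u : H2 Ω) : Measurable u.jetNorm :=
  Finset.measurable_fun_sum _ fun o _ => (Lp.stronglyMeasurable (u.jet o)).measurable.abs

theorem IsBoundedC11Domain.isFiniteMeasure (hΩ : IsBoundedC11Domain Ω) :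
    IsFiniteMeasure (leb Ω) :=
  ⟨by rw [Measure.restrict_apply_univ]; exact hΩ.isBounded.measure_lt_top⟩

theorem eLpNorm'_coe_Lp_two {α : Type*} [MeasurableSpace α] {μ : Measure α} (u : Lp ℝ 2 μ) :
    eLpNorm' u 2 μ = ‖u‖ₑ := by
  rw [Lp.enorm_def, eLpNorm_eq_eLpNorm' (by simp) (by simp), ENNReal.toReal_ofNat]

/-- The `H¹` embedding is applied to `u` and to each `∂ᵢu`, whose weak gradient consists of second
derivatives; this is where `H²` is needed. -/
theorem IsBoundedC11Domain.exists_eLpNorm'_jetNorm_le (hΩ : IsBoundedC11Domain Ω) {q : ℝ}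
    (hq : 2 ≤ q) (hqn : (n : ℝ) * (1 / 2 - 1 / q) < 1) :
    ∃ K : ℝ≥0, ∀ s : H2 Ω, eLpNorm' s.jetNorm q (leb Ω) ≤ K * ‖s‖ₑ := by
  have := hΩ.isFiniteMeasure
  obtain ⟨C, hC, h⟩ := hΩ.localSobolevBound_univ hq hqn
  rw [Set.inter_univ] at h
  have hm : ∀ u : Lp ℝ 2 (leb Ω), Measurable u := fun u => (Lp.stronglyMeasurable u).measurable
  have hi : ∀ u : Lp ℝ 2 (leb Ω), Integrable u (leb Ω) := fun u =>
    (Lp.memLp u).integrable one_le_two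
  have hle : ∀ (s : H2 Ω) (l : Label n), ‖s.1 l‖ₑ ≤ ‖s‖ₑ := fun s l => by
    rw [enorm_le_iff_norm_le]
    exact PiLp.norm_apply_le s.1 l
  have hsum : ∀ (s : H2 Ω) (u : Label n) (g : Fin n → Label n),
      (∀ i, IsWeakPartial Ω i (s.1 u) (s.1 (g i))) →
      eLpNorm' (s.1 u) q (leb Ω) ≤ C * (n + 1) * ‖s‖ₑ := by
    intro s u g hw
    refine (h _ _ (hm _) (fun i => hm (s.1 (g i))) (hi _) (fun i => hi _) hw).trans ?_
    simp only [eLpNorm'_coe_Lp_two]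
    rw [mul_assoc]
    gcongr
    calc ‖s.1 u‖ₑ + ∑ i, ‖s.1 (g i)‖ₑ ≤ ‖s‖ₑ + ∑ i : Fin n, ‖s‖ₑ := by
          gcongr
          · exact hle s u
          · exact hle s _
      _ = (n + 1) * ‖s‖ₑ := by simp; ring
  have hjet : ∀ (s : H2 Ω) o, eLpNorm' (s.jet o) q (leb Ω) ≤ C * (n + 1) * ‖s‖ₑ := by
    rintro s (_ | i)
    · exact hsum s (.inl ()) (fun i => .inr (.inl i)) s.2.1
    · exact hsum s (.inr (.inl i)) (fun j => .inr (.inr (i, j))) (s.2.2 i)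
  refine ⟨((n + 1) * (C * (n + 1))).toNNReal, fun s => ?_⟩
  rw [ENNReal.coe_toNNReal (by finiteness)]
  have h1 := eLpNorm'_sum_le (μ := leb Ω) (f := fun o x => |s.jet o x|) (s := Finset.univ)
    (fun o _ => (hm (s.jet o)).abs.aestronglyMeasurable) (q := q) (by linarith)
  have h2 : (∑ o, fun x => |s.jet o x|) = s.jetNorm := by
    funext x
    simp [H2.jetNorm]
  rw [h2] at h1
  refine h1.trans ?_
  calc ∑ o, eLpNorm' (fun x => |s.jet o x|) q (leb Ω)
      = ∑ o, eLpNorm' (s.jet o) q (leb Ω) :=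
        Finset.sum_congr rfl fun o _ => eLpNorm'_norm (f := s.jet o)
    _ ≤ ∑ _o : Option (Fin n), C * (n + 1) * ‖s‖ₑ := Finset.sum_le_sum fun o _ => hjet s o
    _ = _ := by
        rw [Finset.sum_const, Finset.card_univ, Fintype.card_option, Fintype.card_fin,
          nsmul_eq_mul]
        push_cast
        ring

/-- For `n > 2` and `q > 0` the last condition says `q < 2n / (n - 2)`, so `q` fits strictly between
`max p 2` and the critical exponent; for `n ≤ 2` every finite `q ≥ 2` qualifies. The strict gap `p <
q` is what semismoothness consumes. -/
theorem exists_subcritical_exponent {p : ℝ}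
    (hp : 2 < n → p < 2 * (n : ℝ) / ((n : ℝ) - 2)) :
    ∃ q : ℝ, 2 ≤ q ∧ p < q ∧ (n : ℝ) * (1 / 2 - 1 / q) < 1 := by
  by_cases hn : 2 < n
  · have hn' : (2 : ℝ) < n := by exact_mod_cast hn
    have h1 : max p 2 < 2 * (n : ℝ) / ((n : ℝ) - 2) := by
      refine max_lt (hp hn) ?_
      rw [lt_div_iff₀ (by linarith)]
      linarith
    obtain ⟨q, hq1, hq2⟩ := exists_between h1
    have hq : 2 < q := (le_max_right _ _).trans_lt hq1
    refine ⟨q, hq.le, (le_max_left _ _).trans_lt hq1, ?_⟩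
    rw [lt_div_iff₀ (by linarith)] at hq2
    have hq0 : 0 < q := by linarith
    have h2 : (n : ℝ) * (1 / 2 - 1 / q) = n * (q - 2) / (2 * q) := by field_simp
    rw [h2, div_lt_one (by positivity)]
    linarith
  · have hn' : (n : ℝ) ≤ 2 := by exact_mod_cast not_lt.1 hn
    have hq : 2 < max p 2 + 1 := by linarith [le_max_right p 2]
    refine ⟨max p 2 + 1, hq.le, by linarith [le_max_left p 2], ?_⟩
    have h1 : 0 < 1 / (max p 2 + 1) := by positivity
    have h2 : 1 / (max p 2 + 1) < 1 / 2 := one_div_lt_one_div_of_lt two_pos hq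
    nlinarith

/-- The bound in `L^p(Ω)`, for an exponent `p ≤ q`. -/
theorem eLpNorm_jetNorm_le (hΩ : IsBoundedC11Domain Ω) {p : ℝ≥0} (hp1 : 1 ≤ p) {q : ℝ}
    (hpq : (p : ℝ) ≤ q) {K : ℝ≥0}
    (hK : ∀ s : H2 Ω, eLpNorm' s.jetNorm q (leb Ω) ≤ K * ‖s‖ₑ) :
    ∃ K' : ℝ≥0, ∀ s : H2 Ω, eLpNorm s.jetNorm p (leb Ω) ≤ K' * ‖s‖ₑ := by
  have := hΩ.isFiniteMeasure
  have hp0 : (0 : ℝ) < p := lt_of_lt_of_le one_pos hp1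
  set m := leb Ω Set.univ ^ (1 / (p : ℝ) - 1 / q)
  have hm : m ≠ ⊤ := ENNReal.rpow_ne_top_of_nonneg
    (sub_nonneg.2 (one_div_le_one_div_of_le hp0 hpq)) (measure_ne_top _ _)
  refine ⟨K * m.toNNReal, fun s => ?_⟩
  rw [eLpNorm_eq_eLpNorm' (by exact_mod_cast hp0.ne') ENNReal.coe_ne_top, ENNReal.coe_toReal]
  refine (eLpNorm'_le_eLpNorm'_mul_rpow_measure_univ hp0 hpq
    s.measurable_jetNorm.aestronglyMeasurable).trans ?_
  rw [ENNReal.coe_mul, ENNReal.coe_toNNReal hm, mul_right_comm]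
  gcongr
  exact hK s

theorem H2.norm_le_of_ae_abs_le {p : ℝ≥0∞} [Fact (1 ≤ p)] {K : ℝ≥0}
    (hK : ∀ s : H2 Ω, eLpNorm s.jetNorm p (leb Ω) ≤ K * ‖s‖ₑ) {C : ℝ} (hC : 0 ≤ C) (s : H2 Ω)
    (g : Lp ℝ p (leb Ω)) (h : ∀ᵐ x ∂(leb Ω), |g x| ≤ C * s.jetNorm x) :
    ‖g‖ ≤ C * K * ‖s‖ := by
  have h1 : eLpNorm g p (leb Ω) ≤ ENNReal.ofReal C * eLpNorm s.jetNorm p (leb Ω) := by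
    refine eLpNorm_le_mul_eLpNorm_of_ae_le_mul (h.mono fun x hx => ?_) p
    rwa [Real.norm_eq_abs, Real.norm_of_nonneg (s.jetNorm_nonneg x)]
  have h2 : eLpNorm g p (leb Ω) ≤ ENNReal.ofReal (C * K * ‖s‖) := by
    refine h1.trans ?_
    rw [mul_assoc, ENNReal.ofReal_mul hC, ENNReal.ofReal_mul K.coe_nonneg, ofReal_norm,
      ENNReal.ofReal_coe_nnreal]
    gcongr
    exact hK s
  rw [Lp.norm_def]
  exact ENNReal.toReal_le_of_le_ofReal (by positivity) h2

theorem H2.abs_jet_le_jetNorm (s : H2 Ω) (o : Option (Fin n)) (x : E n) :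
    |s.jet o x| ≤ s.jetNorm x :=
  Finset.single_le_sum (f := fun o => |s.jet o x|) (fun _ _ => abs_nonneg _) (Finset.mem_univ o)

/-- The embedding `H²(Ω) → L^p(Ω)`, `v ↦ ∂ₒ v`. -/
theorem H2.exists_jet_clm {p : ℝ≥0∞} [Fact (1 ≤ p)] {K : ℝ≥0}
    (hK : ∀ s : H2 Ω, eLpNorm s.jetNorm p (leb Ω) ≤ K * ‖s‖ₑ) (o : Option (Fin n)) :
    ∃ J : H2 Ω →L[ℝ] Lp ℝ p (leb Ω), ∀ v, J v =ᵐ[leb Ω] v.jet o := by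
  have hmem : ∀ v : H2 Ω, MemLp (v.jet o) p (leb Ω) := fun v => by
    refine ⟨(Lp.stronglyMeasurable _).aestronglyMeasurable, ?_⟩
    refine (eLpNorm_mono_real (fun x => v.abs_jet_le_jetNorm o x)).trans_lt
      ((hK v).trans_lt ?_)
    finiteness
  let L : H2 Ω →ₗ[ℝ] Lp ℝ p (leb Ω) :=
    { toFun := fun v => (hmem v).toLp
      map_add' := fun u v => by
        rw [← MemLp.toLp_add]
        refine MemLp.toLp_congr _ _ ?_
        rw [H2.jet_add]
        exact Lp.coeFn_add _ _
      map_smul' := fun t v => by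
        rw [RingHom.id_apply, ← MemLp.toLp_const_smul]
        refine MemLp.toLp_congr _ _ ?_
        rw [H2.jet_smul]
        exact Lp.coeFn_smul _ _ }
  refine ⟨L.mkContinuous K fun v => ?_, fun v => MemLp.coeFn_toLp (hmem v)⟩
  have := H2.norm_le_of_ae_abs_le hK zero_le_one v (L v) (by
    filter_upwards [MemLp.coeFn_toLp (hmem v)] with x hx
    rw [one_mul]
    exact (congrArg abs hx).trans_le (v.abs_jet_le_jetNorm o x))
  rwa [one_mul] at this

end Jet

/-! ### Minimizing selectors and the operators they define. -/

section Selectors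

variable {n : ℕ} {Ω : Set (E n)} {A B : Type*}

/-- The coefficients `c` (label `none`) and `bⁱ` (label `some i`). -/
def coeff (b : Fin n → E n → A → B → ℝ) (c : E n → A → B → ℝ) :
    Option (Fin n) → E n → A → B → ℝ
  | none => c
  | some i => b i

theorem hamiltonian_jet (b : Fin n → E n → A → B → ℝ) (c f : E n → A → B → ℝ) (u : H2 Ω)
    (x : E n) (α : A) (β : B) :
    hamiltonian b c f x (u.fn x) (fun i => u.partialDeriv i x) α β =
      ∑ o, coeff b c o x α β * u.jet o x - f x α β := by
  rw [hamiltonian, Fintype.sum_option, add_comm]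
  rfl

theorem isCoefficient_coeff [TopologicalSpace B] {b : Fin n → E n → A → B → ℝ} {c : E n → A → B → ℝ}
    (hb : ∀ i, IsCoefficient Ω (b i)) (hc : IsCoefficient Ω c) (o : Option (Fin n)) :
    IsCoefficient Ω (coeff b c o) := by
  cases o with
  | none => exact hc
  | some i => exact hb i

variable [MetricSpace B] [CompactSpace B]

theorem exists_jointlyMeasurable_argmin [Countable A] [MeasurableSpace A]
    [DiscreteMeasurableSpace A] [Nonempty B] [MeasurableSpace B] [BorelSpace B]
    (hΩ : MeasurableSet Ω) {b : Fin n → E n → A → B → ℝ} {c f : E n → A → B → ℝ}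
    (hb : ∀ i, IsCoefficient Ω (b i)) (hc : IsCoefficient Ω c) (hf : IsCoefficient Ω f)
    {z : E n → ℝ} {q : Fin n → E n → ℝ} (hz : AEMeasurable z (leb Ω))
    (hq : ∀ i, AEMeasurable (q i) (leb Ω)) :
    ∃ β : E n → A → B, JointlyMeasurable Ω β ∧ ∀ x ∈ Ω, ∀ α β',
      hamiltonian b c f x (z x) (fun i => q i x) α (β x α) ≤
        hamiltonian b c f x (z x) (fun i => q i x) α β' := by
  have key : ∀ α : A, ∃ β : NullMeasurableSpace (E n) (leb Ω) → B, Measurable β ∧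
      -- Continuity in `β` is known only for `x ∈ Ω`; cutting off by the indicator makes it hold at
      -- every point. Working on `NullMeasurableSpace` turns almost everywhere measurability into
      -- genuine measurability for the completed `σ`-algebra.
      ∀ x β', Ω.indicator (fun x => hamiltonian b c f x (z x) (fun i => q i x) α (β x)) x ≤
        Ω.indicator (fun x => hamiltonian b c f x (z x) (fun i => q i x) α β') x := by
    intro α
    let h : NullMeasurableSpace (E n) (leb Ω) → B → ℝ := fun x β =>
      Ω.indicator (fun x => hamiltonian b c f x (z x) (fun i => q i x) α β) x
    have hm : ∀ β, Measurable fun x => h x β := by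
      intro β
      have h1 : AEMeasurable (fun x => hamiltonian b c f x (z x) (fun i => q i x) α β)
          (leb Ω) := by
        unfold hamiltonian
        refine AEMeasurable.sub (AEMeasurable.add ?_ ((hc.measurable α β).mul hz))
          (hf.measurable α β)
        exact Finset.aemeasurable_fun_sum _ fun i _ => ((hb i).measurable α β).mul (hq i)
      exact (h1.indicator hΩ).nullMeasurable.measurable'
    have hcont : ∀ x : E n, Continuous fun β =>
        Ω.indicator (fun x => hamiltonian b c f x (z x) (fun i => q i x) α β) x := by
      intro x
      by_cases hx : x ∈ Ω
      · simp only [Set.indicator_of_mem hx, hamiltonian]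
        refine Continuous.sub (Continuous.add ?_ ((hc.continuous x hx α).mul continuous_const))
          (hf.continuous x hx α)
        exact continuous_finsetSum _ fun i _ =>
          ((hb i).continuous x hx α).mul continuous_const
      · simp only [Set.indicator_of_notMem hx]
        exact continuous_const
    obtain ⟨β, hβ, hmin⟩ := exists_measurable_argmin hm hcont
    refine ⟨β, hβ, fun x β' => ?_⟩
    have := hmin x β'
    by_cases hx : (x : E n) ∈ Ω
    · simpa [h, Set.indicator_of_mem hx] using this
    · simp only [Set.indicator_of_notMem hx, le_refl]
  choose β hβ hmin using key
  refine ⟨fun x α => β α x, ?_, fun x hx α β' => ?_⟩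
  · exact measurable_from_prod_countable_left hβ
  · simpa [Set.indicator_of_mem hx] using hmin α x β'

/-- A Carathéodory function on a separable metric space is jointly measurable, so inserting a
measurable control preserves measurability. -/
theorem IsCoefficient.aemeasurable_comp [MeasurableSpace A] [MeasurableSpace B] [BorelSpace B]
    (hΩ : MeasurableSet Ω) {φ : E n → A → B → ℝ} (hφ : IsCoefficient Ω φ) {β : E n → A → B}
    (hβ : JointlyMeasurable Ω β) (α : A) :
    AEMeasurable (fun x => φ x α (β x α)) (leb Ω) := by
  have h1 : Measurable fun x : NullMeasurableSpace (E n) (leb Ω) => β x α :=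
    Measurable.comp (g := fun y : NullMeasurableSpace (E n) (leb Ω) × A => β y.1 y.2) hβ
      (measurable_id.prodMk measurable_const)
  have h2 : Measurable (Function.uncurry fun (b : B) (x : NullMeasurableSpace (E n) (leb Ω)) =>
      Ω.indicator (fun x => φ x α b) x) := by
    refine measurable_uncurry_of_continuous_of_measurable (fun x => ?_) fun b => ?_
    · by_cases hx : (x : E n) ∈ Ω
      · exact (hφ.continuous x hx α).congr fun b =>
          (Set.indicator_of_mem (s := Ω) hx fun x => φ x α b).symm
      · exact (continuous_const (y := 0)).congr fun b =>
          (Set.indicator_of_notMem (s := Ω) hx fun x => φ x α b).symm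
    · exact ((hφ.measurable α b).indicator hΩ).nullMeasurable.measurable'
  have h3 : NullMeasurable (fun x : E n => Ω.indicator (fun y => φ y α (β x α)) x) (leb Ω) :=
    h2.comp (h1.prodMk measurable_id)
  refine h3.aemeasurable.congr ?_
  filter_upwards [ae_restrict_mem hΩ] with x hx
  simp [Set.indicator_of_mem hx]

theorem IsCoefficient.memLp_comp [MeasurableSpace A] [MeasurableSpace B] [BorelSpace B]
    (hΩ : MeasurableSet Ω) {φ : E n → A → B → ℝ} (hφ : IsCoefficient Ω φ) {β : E n → A → B}
    (hβ : JointlyMeasurable Ω β) (α : A) :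
    MemLp (fun x => φ x α (β x α)) ⊤ (leb Ω) := by
  obtain ⟨C, hC⟩ := hφ.bounded
  exact memLp_top_of_bound (hφ.aemeasurable_comp hΩ hβ α).aestronglyMeasurable C
    (hC.mono fun x hx => hx α _)

theorem exists_isControlledOperator [Fintype A] [MeasurableSpace A] [MeasurableSpace B]
    [BorelSpace B] (hΩ : MeasurableSet Ω) {p : ℝ≥0∞} [Fact (1 ≤ p)] {K : ℝ≥0}
    (hK : ∀ s : H2 Ω, eLpNorm s.jetNorm p (leb Ω) ≤ K * ‖s‖ₑ)
    {b : Fin n → E n → A → B → ℝ} {c : E n → A → B → ℝ}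
    (hb : ∀ i, IsCoefficient Ω (b i)) (hc : IsCoefficient Ω c)
    {β : E n → A → B} (hβ : JointlyMeasurable Ω β) :
    ∃ M : H2 Ω →L[ℝ] LpFamily A p Ω, IsControlledOperator b c β M := by
  have hm := fun (o : Option (Fin n)) α =>
    (isCoefficient_coeff hb hc o).memLp_comp hΩ hβ α
  choose J hJ using H2.exists_jet_clm (Ω := Ω) hK
  -- Hölder's inequality with exponents `∞` and `p`: a bounded coefficient acts on the embedded jet
  -- component.
  let T : A → Option (Fin n) → H2 Ω →L[ℝ] Lp ℝ p (leb Ω) := fun α o =>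
    ((ContinuousLinearMap.mul ℝ ℝ).holderL (leb Ω) ⊤ p p ((hm o α).toLp)).comp (J o)
  have hT : ∀ α o v, T α o v =ᵐ[leb Ω] fun x => coeff b c o x α (β x α) * v.jet o x := by
    intro α o v
    filter_upwards [ContinuousLinearMap.coeFn_holder (r := p) (ContinuousLinearMap.mul ℝ ℝ)
      (hm o α).toLp (J o v), (hm o α).coeFn_toLp, hJ o v] with x h1 h2 h3
    refine h1.trans ?_
    rw [h2, h3]
    rfl
  refine ⟨((PiLp.continuousLinearEquiv 1 ℝ fun _ : A => Lp ℝ p (leb Ω)).symm :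
    (A → Lp ℝ p (leb Ω)) →L[ℝ] LpFamily A p Ω).comp
      (ContinuousLinearMap.pi fun α => ∑ o, T α o), fun v α => ?_⟩
  have h0 : (((PiLp.continuousLinearEquiv 1 ℝ fun _ : A => Lp ℝ p (leb Ω)).symm :
    (A → Lp ℝ p (leb Ω)) →L[ℝ] LpFamily A p Ω).comp
      (ContinuousLinearMap.pi fun α => ∑ o, T α o)) v α = ∑ o, T α o v := by
    simp
  rw [h0]
  have hall : ∀ᵐ x ∂(leb Ω), ∀ o, T α o v x = coeff b c o x α (β x α) * v.jet o x :=
    ae_all_iff.2 fun o => hT α o v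
  filter_upwards [hall, Lp.coeFn_finsetSum Finset.univ fun o => T α o v] with x h1 h2
  rw [h2, Finset.sum_apply, Fintype.sum_option, h1 none, add_comm]
  simp only [h1]
  rfl

end Selectors

/-! ### Minima of compact families of affine functions. -/

section Pointwise

variable {O B : Type*} [Fintype O] {a : O → B → ℝ} {f : B → ℝ} {C : ℝ}

theorem abs_sum_mul_le_mul_sum_abs (hC : ∀ o β, |a o β| ≤ C) (β : B) (s : O → ℝ) :
    |∑ o, a o β * s o| ≤ C * ∑ o, |s o| := by
  rw [Finset.mul_sum]
  refine (Finset.abs_sum_le_sum_abs _ _).trans (Finset.sum_le_sum fun o _ => ?_)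
  rw [abs_mul]
  gcongr
  exact hC o β

variable [TopologicalSpace B] [CompactSpace B]

theorem bddBelow_range_affine (ha : ∀ o, Continuous (a o)) (hf : Continuous f) (y : O → ℝ) :
    BddBelow (Set.range fun β => ∑ o, a o β * y o - f β) :=
  (isCompact_range ((continuous_finsetSum _ fun o _ => (ha o).mul continuous_const).sub
    hf)).bddBelow

variable [Nonempty B]

theorem iInf_affine_sub_le (ha : ∀ o, Continuous (a o)) (hf : Continuous f)
    (hC : ∀ o β, |a o β| ≤ C) (y z : O → ℝ) :
    (⨅ β, (∑ o, a o β * y o - f β)) - ⨅ β, (∑ o, a o β * z o - f β) ≤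
      C * ∑ o, |y o - z o| := by
  rw [sub_le_iff_le_add', ← sub_le_iff_le_add]
  refine le_ciInf fun β => ?_
  have h1 := ciInf_le (bddBelow_range_affine ha hf y) β
  have h2 := le_of_abs_le (abs_sum_mul_le_mul_sum_abs hC β fun o => y o - z o)
  simp only [mul_sub, Finset.sum_sub_distrib] at h2
  linarith

theorem abs_iInf_affine_sub_le (ha : ∀ o, Continuous (a o)) (hf : Continuous f)
    (hC : ∀ o β, |a o β| ≤ C) (y z : O → ℝ) :
    |(⨅ β, (∑ o, a o β * y o - f β)) - ⨅ β, (∑ o, a o β * z o - f β)| ≤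
      C * ∑ o, |y o - z o| := by
  refine abs_sub_le_iff.2 ⟨iInf_affine_sub_le ha hf hC y z, ?_⟩
  simpa only [abs_sub_comm] using iInf_affine_sub_le ha hf hC z y

/-- The crude `O(|s|)` bound with a constant uniform in the base point, which supplies the
dominating function later. -/
theorem abs_iInf_affine_add_sub_sub_le (ha : ∀ o, Continuous (a o)) (hf : Continuous f)
    (hC : ∀ o β, |a o β| ≤ C) (y s : O → ℝ) (β : B) :
    |(⨅ β, (∑ o, a o β * (y o + s o) - f β)) - (⨅ β, (∑ o, a o β * y o - f β)) -
      ∑ o, a o β * s o| ≤ 2 * C * ∑ o, |s o| := by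
  have h1 := abs_iInf_affine_sub_le ha hf hC (fun o => y o + s o) y
  have h2 := abs_sum_mul_le_mul_sum_abs hC β s
  simp only [add_sub_cancel_left] at h1
  refine (abs_sub _ _).trans ?_
  linarith

/-- A minimum of a compact family of affine functions is semismooth with respect to the slopes of
the affine functions that are active at the perturbed point. -/
theorem exists_forall_abs_iInf_affine_le (ha : ∀ o, Continuous (a o)) (hf : Continuous f)
    (hC : ∀ o β, |a o β| ≤ C) (y : O → ℝ) {ε : ℝ} (hε : 0 < ε) :
    ∃ δ > 0, ∀ s : O → ℝ, ∑ o, |s o| < δ → ∀ β,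
      (∀ β', ∑ o, a o β * (y o + s o) - f β ≤ ∑ o, a o β' * (y o + s o) - f β') →
      |(⨅ β, (∑ o, a o β * (y o + s o) - f β)) - (⨅ β, (∑ o, a o β * y o - f β)) -
        ∑ o, a o β * s o| ≤ ε * ∑ o, |s o| := by
  set l : (O → ℝ) → B → ℝ := fun y β => ∑ o, a o β * y o - f β with hl
  have hlc : ∀ y, Continuous (l y) := fun y =>
    (continuous_finsetSum _ fun o _ => (ha o).mul continuous_const).sub hf
  have hladd : ∀ (s : O → ℝ) β, l (fun o => y o + s o) β = l y β + ∑ o, a o β * s o := fun s β => by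
    simp only [hl, mul_add, Finset.sum_add_distrib]; ring
  obtain ⟨β₀, -, hβ₀⟩ := isCompact_univ.exists_isMinOn Set.univ_nonempty (hlc y).continuousOn
  have hβ₀' : ∀ β, l y β₀ ≤ l y β := fun β => isMinOn_iff.1 hβ₀ β trivial
  have hC0 : ∀ s : O → ℝ, 0 ≤ ∑ o, |s o| := fun s => Finset.sum_nonneg fun _ _ => abs_nonneg _
  -- The indices whose slope is `ε`-close to a slope active at `y`. Off this open set compactness
  -- leaves a positive gap `η` above the minimum.
  set U : Set B := ⋃ β' ∈ {β' | l y β' = l y β₀}, ⋂ o, {β | |a o β - a o β'| < ε} with hU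
  have hUo : IsOpen U := isOpen_biUnion fun β' _ => isOpen_iInter_of_finite fun o =>
    isOpen_lt ((ha o).sub continuous_const).abs continuous_const
  have hgap : ∃ η > 0, ∀ β ∉ U, l y β₀ + η ≤ l y β := by
    rcases (Uᶜ).eq_empty_or_nonempty with hemp | hne
    · exact ⟨1, one_pos, fun β hβ => absurd (hemp ▸ hβ : β ∈ (∅ : Set B)) (by simp)⟩
    · obtain ⟨β₁, hβ₁, hmin⟩ := hUo.isClosed_compl.isCompact.exists_isMinOn hne
        (hlc y).continuousOn
      refine ⟨l y β₁ - l y β₀, ?_, fun β hβ => ?_⟩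
      · refine sub_pos.2 (lt_of_le_of_ne (hβ₀' β₁) fun heq => hβ₁ ?_)
        simp only [hU, Set.mem_iUnion, Set.mem_iInter]
        exact ⟨β₁, heq.symm, fun o => by simpa using hε⟩
      · have := isMinOn_iff.1 hmin β hβ
        linarith
  obtain ⟨η, hη, hgap⟩ := hgap
  -- The perturbation changes the values at `β` and at `β₀` by at most `|C| * ∑ |s o|` each,
  -- together less than `η`. A minimizer at `y + s` thus cannot lie off `U`.
  refine ⟨η / (2 * |C| + 1), by positivity, fun s hs β hβ => ?_⟩
  have hinf : ⨅ β, l (fun o => y o + s o) β = l (fun o => y o + s o) β :=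
    le_antisymm (ciInf_le (bddBelow_range_affine ha hf _) β) (le_ciInf hβ)
  have hinf₀ : ⨅ β, l y β = l y β₀ :=
    le_antisymm (ciInf_le (bddBelow_range_affine ha hf _) β₀) (le_ciInf hβ₀')
  change |(⨅ β, l (fun o => y o + s o) β) - (⨅ β, l y β) - ∑ o, a o β * s o| ≤ _
  rw [hinf, hinf₀, hladd]
  have hmem : β ∈ U := by
    by_contra hβU
    have h1 := hgap β hβU
    have h2 : l y β + ∑ o, a o β * s o ≤ l y β₀ + ∑ o, a o β₀ * s o := by
      rw [← hladd, ← hladd]; exact hβ β₀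
    have h3 := (abs_le.1 (abs_sum_mul_le_mul_sum_abs hC β s)).1
    have h4 := (abs_le.1 (abs_sum_mul_le_mul_sum_abs hC β₀ s)).2
    rw [lt_div_iff₀ (by positivity)] at hs
    have h5 : C * ∑ o, |s o| ≤ |C| * ∑ o, |s o| :=
      mul_le_mul_of_nonneg_right (le_abs_self C) (hC0 s)
    have h6 := hC0 s
    nlinarith
  simp only [hU, Set.mem_iUnion, Set.mem_iInter] at hmem
  obtain ⟨β', hβ', hclose⟩ := hmem
  have hβ'y : l y β' = l y β₀ := hβ'
  -- The remainder is just `l y β - l y β₀`. It is nonnegative by minimality of `β₀` at `y`, and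
  -- minimality of `β` at `y + s` against the active `β'` bounds it by the difference of the two
  -- slopes applied to `s`.
  have h1 : l y β + ∑ o, a o β * s o ≤ l y β' + ∑ o, a o β' * s o := by
    rw [← hladd, ← hladd]; exact hβ β'
  have h2 : |∑ o, a o β' * s o - ∑ o, a o β * s o| ≤ ε * ∑ o, |s o| := by
    rw [← Finset.sum_sub_distrib, Finset.mul_sum]
    refine (Finset.abs_sum_le_sum_abs _ _).trans (Finset.sum_le_sum fun o _ => ?_)
    rw [← sub_mul, abs_mul, abs_sub_comm]
    exact mul_le_mul_of_nonneg_right (hclose o).le (abs_nonneg _)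
  have h3 := (abs_le.1 h2).2
  have h4 := hβ₀' β
  rw [abs_le]
  constructor
  · have := mul_nonneg hε.le (hC0 s)
    linarith
  · linarith

end Pointwise

/-- If `R k = o(W k)` pointwise and `R k = O(W k)` uniformly then the norm of `R k` in `L^p` is
negligible with respect to the norm of `W k` in `L^q`, `p < q`. -/
theorem exists_tendsto_zero_eLpNorm'_le {α : Type*} [MeasurableSpace α] {μ : Measure α}
    [IsFiniteMeasure μ] {p q : ℝ} (hp : 0 < p) (hpq : p < q) {R W : ℕ → α → ℝ} {C : ℝ}
    (hR : ∀ k, AEMeasurable (R k) μ) (hW : ∀ k, AEMeasurable (W k) μ) (hW0 : ∀ k x, 0 ≤ W k x)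
    (hRW : ∀ k, ∀ᵐ x ∂μ, |R k x| ≤ C * W k x)
    (hlim : ∀ᵐ x ∂μ, ∀ ε > 0, ∀ᶠ k in atTop, |R k x| ≤ ε * W k x) :
    ∃ c : ℕ → ℝ≥0∞, Tendsto c atTop (𝓝 0) ∧
      ∀ k, eLpNorm' (R k) p μ ≤ c k * eLpNorm' (W k) q μ := by
  have hq : 0 < q := hp.trans hpq
  -- The Hölder exponent for the factorization `R = (R / W) * W`. It is finite because `p < q`, so
  -- dominated convergence applies to the bounded quotient on a finite measure space.
  set r : ℝ := (1 / p - 1 / q)⁻¹ with hr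
  have hr0 : 0 < r := inv_pos.2 (sub_pos.2 (one_div_lt_one_div_of_lt hp hpq))
  have hpqr : 1 / p = 1 / r + 1 / q := by rw [hr, one_div, one_div, inv_inv]; ring
  have hpr : p < r := by
    refine lt_of_one_div_lt_one_div hr0 ?_
    have : 0 < 1 / q := by positivity
    linarith
  set g : ℕ → α → ℝ := fun k x => R k x / W k x with hg
  have hgm : ∀ k, AEMeasurable (g k) μ := fun k => (hR k).div (hW k)
  have hdiv : ∀ k x t, 0 ≤ t → |R k x| ≤ t * W k x → |g k x| ≤ t := by
    intro k x t ht h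
    simp only [hg, abs_div, abs_of_nonneg (hW0 k x)]
    exact div_le_of_le_mul₀ (hW0 k x) ht h
  refine ⟨fun k => (∫⁻ x, ‖g k x‖ₑ ^ r ∂μ) ^ (1 / r), ?_, fun k => ?_⟩
  · have h1 : Tendsto (fun k => ∫⁻ x, ‖g k x‖ₑ ^ r ∂μ) atTop (𝓝 (∫⁻ _, 0 ∂μ)) := by
      refine tendsto_lintegral_of_dominated_convergence' (fun _ => ENNReal.ofReal |C| ^ r)
        (fun k => (hgm k).enorm.pow_const r) (fun k => ?_) ?_ ?_
      · filter_upwards [hRW k] with x hx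
        gcongr
        rw [Real.enorm_eq_ofReal_abs]
        exact ENNReal.ofReal_le_ofReal (hdiv k x _ (abs_nonneg C) (hx.trans
          (mul_le_mul_of_nonneg_right (le_abs_self C) (hW0 k x))))
      · rw [lintegral_const]
        exact ENNReal.mul_ne_top (ENNReal.rpow_ne_top_of_nonneg hr0.le ENNReal.ofReal_ne_top)
          (measure_ne_top _ _)
      · filter_upwards [hlim] with x hx
        have h2 : Tendsto (fun k => g k x) atTop (𝓝 0) := by
          rw [Metric.tendsto_nhds]
          intro ε hε
          filter_upwards [hx (ε / 2) (half_pos hε)] with k hk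
          rw [Real.dist_eq, sub_zero]
          have := hdiv k x _ (half_pos hε).le hk
          linarith
        have h3 := (ENNReal.continuous_rpow_const (y := r)).tendsto 0 |>.comp
          ((continuous_enorm.tendsto (0 : ℝ)).comp h2 |>.trans (by simp))
        rw [ENNReal.zero_rpow_of_pos hr0] at h3
        exact h3
    rw [lintegral_zero] at h1
    have h2 := (ENNReal.continuous_rpow_const (y := 1 / r)).tendsto 0 |>.comp h1
    rw [ENNReal.zero_rpow_of_pos (by positivity)] at h2
    exact h2
  · have h1 : eLpNorm' (R k) p μ =
        (∫⁻ x, ((fun x => ‖g k x‖ₑ) * fun x => ‖W k x‖ₑ) x ^ p ∂μ) ^ (1 / p) := by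
      rw [eLpNorm']
      congr 1
      refine lintegral_congr_ae ?_
      filter_upwards [hRW k] with x hx
      congr 1
      rw [Pi.mul_apply, ← enorm_mul]
      congr 1
      -- Where `W` vanishes the quotient is `0` by convention, and `R` vanishes too by the uniform
      -- bound.
      by_cases h0 : W k x = 0
      · rw [h0, mul_zero] at hx
        rw [h0, mul_zero, abs_eq_zero.1 (le_antisymm hx (abs_nonneg _))]
      · simp only [hg, div_mul_cancel₀ _ h0]
    rw [h1]
    exact ENNReal.lintegral_Lp_mul_le_Lq_mul_Lr hp hpr hpqr μ (hgm k).enorm (hW k).enorm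

/-! ### The HJB operator: values in `L^p`, Lipschitz bound, semismoothness. -/

section Operator

variable {n : ℕ} {Ω : Set (E n)} {A B : Type*}
  {b : Fin n → E n → A → B → ℝ} {c f : E n → A → B → ℝ}

/-- The pointwise value `min_β ℓ(x, u(x), ∇u(x), α, β)` of the HJB operator. -/
noncomputable def hjbValue (b : Fin n → E n → A → B → ℝ) (c f : E n → A → B → ℝ) (u : H2 Ω)
    (α : A) (x : E n) : ℝ :=
  ⨅ β, hamiltonian b c f x (u.fn x) (fun i => u.partialDeriv i x) α β

theorem hjbValue_eq (b : Fin n → E n → A → B → ℝ) (c f : E n → A → B → ℝ) (u : H2 Ω)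
    (α : A) (x : E n) :
    hjbValue b c f u α x = ⨅ β, (∑ o, coeff b c o x α β * u.jet o x - f x α β) := by
  simp only [hjbValue, hamiltonian_jet]

theorem H2.ae_jet_sub (u v : H2 Ω) : ∀ᵐ x ∂(leb Ω), ∀ o,
    (u - v).jet o x = u.jet o x - v.jet o x := by
  refine ae_all_iff.2 fun o => ?_
  have : (u - v).jet o = u.jet o - v.jet o := by cases o <;> rfl
  rw [this]
  exact Lp.coeFn_sub _ _

theorem H2.ae_jet_add (u v : H2 Ω) : ∀ᵐ x ∂(leb Ω), ∀ o,
    (u + v).jet o x = u.jet o x + v.jet o x := by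
  refine ae_all_iff.2 fun o => ?_
  rw [H2.jet_add]
  exact Lp.coeFn_add _ _

theorem exists_ae_forall_abs_coeff_le [TopologicalSpace B] (hb : ∀ i, IsCoefficient Ω (b i))
    (hc : IsCoefficient Ω c) :
    ∃ C : ℝ, 0 ≤ C ∧ ∀ᵐ x ∂(leb Ω), ∀ o α β, |coeff b c o x α β| ≤ C := by
  choose C hC using fun o => (isCoefficient_coeff hb hc o).bounded
  refine ⟨∑ o, |C o|, Finset.sum_nonneg fun _ _ => abs_nonneg _, ?_⟩
  filter_upwards [ae_all_iff.2 hC] with x hx o α β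
  exact (hx o α β).trans ((le_abs_self _).trans (Finset.single_le_sum
    (f := fun o => |C o|) (fun _ _ => abs_nonneg _) (Finset.mem_univ o)))

theorem IsControlledOperator.ae_eq [Fintype A] {p : ℝ≥0∞} [Fact (1 ≤ p)] {β : E n → A → B}
    {M : H2 Ω →L[ℝ] LpFamily A p Ω} (hM : IsControlledOperator b c β M) (s : H2 Ω) (α : A) :
    M s α =ᵐ[leb Ω] fun x => ∑ o, coeff b c o x α (β x α) * s.jet o x := by
  refine (hM s α).trans (.of_forall fun x => ?_)
  simp only [Fintype.sum_option]
  exact add_comm _ _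

variable [MetricSpace B] [CompactSpace B] [Nonempty B]

theorem exists_isMinSelector [Countable A] [MeasurableSpace A] [DiscreteMeasurableSpace A]
    [MeasurableSpace B] [BorelSpace B] (hΩ : MeasurableSet Ω)
    (hb : ∀ i, IsCoefficient Ω (b i)) (hc : IsCoefficient Ω c) (hf : IsCoefficient Ω f)
    (u : H2 Ω) : ∃ β : E n → A → B, IsMinSelector b c f u β := by
  obtain ⟨β, hβ, hmin⟩ := exists_jointlyMeasurable_argmin hΩ hb hc hf
    (Lp.aestronglyMeasurable u.fn).aemeasurable
    (fun i => (Lp.aestronglyMeasurable (u.partialDeriv i)).aemeasurable)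
  refine ⟨β, hβ, ?_⟩
  filter_upwards [ae_restrict_mem hΩ] with x hx
  exact hmin x hx

/-- Along a minimizing selector the minimum equals `M u - f(·, β)`, so its measurability and
integrability come from the controlled operator and a bounded function. -/
theorem memLp_hjbValue [Fintype A] [MeasurableSpace A] [DiscreteMeasurableSpace A]
    [MeasurableSpace B] [BorelSpace B] (hΩ : MeasurableSet Ω) [IsFiniteMeasure (leb Ω)]
    (hb : ∀ i, IsCoefficient Ω (b i)) (hc : IsCoefficient Ω c) (hf : IsCoefficient Ω f)
    {p : ℝ≥0∞} [Fact (1 ≤ p)] {K : ℝ≥0}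
    (hK : ∀ s : H2 Ω, eLpNorm s.jetNorm p (leb Ω) ≤ K * ‖s‖ₑ) (u : H2 Ω) (α : A) :
    MemLp (hjbValue b c f u α) p (leb Ω) := by
  obtain ⟨β, hβ, hmin⟩ := exists_isMinSelector hΩ hb hc hf u
  obtain ⟨M, hM⟩ := exists_isControlledOperator hΩ hK hb hc hβ
  refine ((Lp.memLp (M u α)).sub ((hf.memLp_comp hΩ hβ α).mono_exponent le_top)).ae_eq ?_
  filter_upwards [hM u α, hmin] with x h1 h2
  rw [Pi.sub_apply, h1]
  have h3 : ∀ β', hamiltonian b c f x (u.fn x) (fun i => u.partialDeriv i x) α (β x α) ≤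
      hamiltonian b c f x (u.fn x) (fun i => u.partialDeriv i x) α β' := h2 α
  exact le_antisymm (le_ciInf h3) (ciInf_le ⟨_, Set.forall_mem_range.2 h3⟩ (β x α))

theorem exists_ae_abs_hjbValue_sub_le (hΩ : MeasurableSet Ω)
    (hb : ∀ i, IsCoefficient Ω (b i)) (hc : IsCoefficient Ω c) (hf : IsCoefficient Ω f) :
    ∃ C : ℝ, 0 ≤ C ∧ ∀ (u v : H2 Ω) (α : A), ∀ᵐ x ∂(leb Ω),
      |hjbValue b c f u α x - hjbValue b c f v α x| ≤ C * (u - v).jetNorm x := by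
  obtain ⟨C, hC0, hC⟩ := exists_ae_forall_abs_coeff_le hb hc
  refine ⟨C, hC0, fun u v α => ?_⟩
  filter_upwards [hC, ae_restrict_mem hΩ, H2.ae_jet_sub u v] with x hx hxΩ hsub
  simp only [hjbValue_eq, H2.jetNorm, hsub]
  exact abs_iInf_affine_sub_le (fun o => (isCoefficient_coeff hb hc o).continuous x hxΩ α)
    (hf.continuous x hxΩ α) (fun o β => hx o α β) _ _

/-- The componentwise semismoothness estimate. -/
theorem eventually_norm_sub_sub_le [Fintype A] [MeasurableSpace A] [MeasurableSpace B]
    (hΩ : IsBoundedC11Domain Ω) (hb : ∀ i, IsCoefficient Ω (b i)) (hc : IsCoefficient Ω c)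
    (hf : IsCoefficient Ω f) {p : ℝ≥0} [Fact (1 ≤ (p : ℝ≥0∞))] {q : ℝ} (hpq : (p : ℝ) < q)
    {K : ℝ≥0} (hK : ∀ s : H2 Ω, eLpNorm' s.jetNorm q (leb Ω) ≤ K * ‖s‖ₑ)
    {F : H2 Ω → LpFamily A (p : ℝ≥0∞) Ω} (hF : ∀ u α, F u α =ᵐ[leb Ω] hjbValue b c f u α)
    (u : H2 Ω) (α : A) {ε : ℝ} (hε : 0 < ε) :
    ∀ᶠ s in 𝓝 (0 : H2 Ω), ∀ M ∈ genDiff (p : ℝ≥0∞) b c f (u + s),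
      ‖(F (u + s) - F u - M s) α‖ ≤ ε * ‖s‖ := by
  have := hΩ.isFiniteMeasure
  have hΩm := hΩ.isOpen.measurableSet
  have hp1 : (1 : ℝ≥0) ≤ p := by exact_mod_cast Fact.out (p := 1 ≤ (p : ℝ≥0∞))
  have hp0 : (0 : ℝ) < p := lt_of_lt_of_le one_pos hp1
  have hq0 : 0 < q := hp0.trans hpq
  -- Negation yields one sequence `s k → 0` with one bad operator `M k` each. This replaces the
  -- supremum over all operators by countably many selectors, whose exceptional null sets can be
  -- united.
  by_contra hcon
  obtain ⟨s, hs0, hs⟩ := exists_seq_forall_of_frequently (not_eventually.1 hcon)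
  push Not at hs
  choose M hM hlt using hs
  choose β hβ hMβ using hM
  have hWlim : TendstoInMeasure (leb Ω) (fun k => (s k).jetNorm) atTop fun _ => 0 := by
    refine tendstoInMeasure_of_tendsto_eLpNorm (p := ENNReal.ofReal q) (by simpa using hq0)
      (fun k => (s k).measurable_jetNorm.aestronglyMeasurable) aestronglyMeasurable_const ?_
    have h1 : Tendsto (fun k => (K : ℝ≥0∞) * ‖s k‖ₑ) atTop (𝓝 0) := by
      have := ENNReal.Tendsto.const_mul ((continuous_enorm.tendsto (0 : H2 Ω)).comp hs0)
        (a := (K : ℝ≥0∞)) (.inr ENNReal.coe_ne_top)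
      rwa [← ofReal_norm (0 : H2 Ω), norm_zero, ENNReal.ofReal_zero, mul_zero] at this
    refine tendsto_of_tendsto_of_tendsto_of_le_of_le tendsto_const_nhds h1
      (fun _ => zero_le) fun k => ?_
    have h2 : ((s k).jetNorm - fun _ => (0 : ℝ)) = (s k).jetNorm := by funext x; simp
    simp only [h2]
    rw [eLpNorm_eq_eLpNorm' (by simpa using hq0) ENNReal.ofReal_ne_top,
      ENNReal.toReal_ofReal hq0.le]
    exact hK (s k)
  -- Smallness in `H²` makes the jets small in `L^q` only, hence in measure; the pointwise lemma
  -- needs almost everywhere convergence, which holds along a subsequence. A single contradictory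
  -- index suffices.
  obtain ⟨ns, -, hns⟩ := hWlim.exists_seq_tendsto_ae
  obtain ⟨C, hC0, hC⟩ := exists_ae_forall_abs_coeff_le hb hc
  set R : ℕ → E n → ℝ := fun k => ((F (u + s k) - F u - M k (s k)) α : Lp ℝ p (leb Ω))
  have hReq : ∀ᵐ x ∂(leb Ω), ∀ k, R k x =
      (⨅ β, (∑ o, coeff b c o x α β * (u.jet o x + (s k).jet o x) - f x α β)) -
        (⨅ β, (∑ o, coeff b c o x α β * u.jet o x - f x α β)) -
        ∑ o, coeff b c o x α (β k x α) * (s k).jet o x := by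
    refine ae_all_iff.2 fun k => ?_
    filter_upwards [Lp.coeFn_sub ((F (u + s k) - F u) α) (M k (s k) α),
      Lp.coeFn_sub (F (u + s k) α) (F u α), hF (u + s k) α, hF u α, (hMβ k).ae_eq (s k) α,
      H2.ae_jet_add u (s k)] with x h1 h2 h3 h4 h5 h6
    refine h1.trans ?_
    rw [Pi.sub_apply, h5]
    refine congrArg (· - _) (h2.trans ?_)
    rw [Pi.sub_apply, h3, h4, hjbValue_eq, hjbValue_eq]
    simp only [h6]
  have hmin : ∀ᵐ x ∂(leb Ω), ∀ k β',
      ∑ o, coeff b c o x α (β k x α) * (u.jet o x + (s k).jet o x) - f x α (β k x α) ≤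
        ∑ o, coeff b c o x α β' * (u.jet o x + (s k).jet o x) - f x α β' := by
    refine ae_all_iff.2 fun k => ?_
    filter_upwards [(hβ k).2, H2.ae_jet_add u (s k)] with x h1 h2 β'
    have := h1 α β'
    rw [hamiltonian_jet, hamiltonian_jet] at this
    simpa only [h2] using this
  have hcont : ∀ x ∈ Ω, ∀ o, Continuous (coeff b c o x α) := fun x hx o =>
    (isCoefficient_coeff hb hc o).continuous x hx α
  obtain ⟨d, hd0, hd⟩ := exists_tendsto_zero_eLpNorm'_le (μ := leb Ω) (C := 2 * C) hp0 hpq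
    (R := fun k => R (ns k)) (W := fun k => (s (ns k)).jetNorm)
    (fun k => (Lp.aestronglyMeasurable _).aemeasurable)
    (fun k => (s (ns k)).measurable_jetNorm.aemeasurable)
    (fun k x => (s (ns k)).jetNorm_nonneg x)
    (fun k => by
      filter_upwards [hReq, hC, ae_restrict_mem hΩm] with x h1 h2 hx
      rw [h1]
      exact abs_iInf_affine_add_sub_sub_le (hcont x hx) (hf.continuous x hx α)
        (fun o β => h2 o α β) _ _ _)
    (by
      filter_upwards [hReq, hC, hmin, hns, ae_restrict_mem hΩm] with x h1 h2 h3 h4 hx η hη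
      obtain ⟨δ, hδ, hsmall⟩ := exists_forall_abs_iInf_affine_le (hcont x hx)
        (hf.continuous x hx α) (fun o β => h2 o α β) (fun o => u.jet o x) hη
      filter_upwards [h4.eventually_lt_const hδ] with k hk
      rw [h1]
      exact hsmall _ hk _ (h3 (ns k)))
  have hdK : Tendsto (fun k => d k * K) atTop (𝓝 0) := by
    have := ENNReal.Tendsto.mul_const hd0 (b := (K : ℝ≥0∞)) (.inr ENNReal.coe_ne_top)
    simpa using this
  obtain ⟨k, hk⟩ := (hdK.eventually_lt_const (ENNReal.ofReal_pos.2 hε)).exists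
  refine absurd (hlt (ns k)) (not_lt.2 ?_)
  have h1 : eLpNorm (R (ns k)) p (leb Ω) ≤ ENNReal.ofReal (ε * ‖s (ns k)‖) := by
    rw [eLpNorm_eq_eLpNorm' (by exact_mod_cast hp0.ne') ENNReal.coe_ne_top, ENNReal.coe_toReal]
    calc eLpNorm' (R (ns k)) p (leb Ω) ≤ d k * eLpNorm' (s (ns k)).jetNorm q (leb Ω) := hd k
      _ ≤ d k * (K * ‖s (ns k)‖ₑ) := by gcongr; exact hK _
      _ ≤ _ := by
        rw [← mul_assoc, ENNReal.ofReal_mul hε.le, ofReal_norm]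
        gcongr
  rw [Lp.norm_def]
  exact ENNReal.toReal_le_of_le_ofReal (by positivity) h1

end Operator

end HJB

theorem mainTheorem6 {n : ℕ} (hn : 1 ≤ n) {Ω : Set (HJB.E n)} (hΩ : HJB.IsBoundedC11Domain Ω)
    {A : Type*} [Fintype A] [Nonempty A] [MeasurableSpace A] [DiscreteMeasurableSpace A]
    {B : Type*} [MetricSpace B] [CompactSpace B] [Nonempty B] [MeasurableSpace B] [BorelSpace B]
    (b : Fin n → HJB.E n → A → B → ℝ) (c f : HJB.E n → A → B → ℝ)
    (hb : ∀ i, HJB.IsCoefficient Ω (b i)) (hc : HJB.IsCoefficient Ω c)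
    (hf : HJB.IsCoefficient Ω f)
    (p : ℝ≥0) [Fact ((1 : ℝ≥0∞) ≤ (p : ℝ≥0∞))]
    (hp : 2 < n → (p : ℝ) < 2 * (n : ℝ) / ((n : ℝ) - 2)) :
    -- for all representatives of `u` and `∇u` there is a jointly measurable selector that
    -- minimizes at every point of `Ω`
    (∀ (u : HJB.H2 Ω) (z : HJB.E n → ℝ) (q : Fin n → HJB.E n → ℝ),
      z =ᵐ[HJB.leb Ω] u.fn → (∀ i, q i =ᵐ[HJB.leb Ω] u.partialDeriv i) →
      ∃ β : HJB.E n → A → B, HJB.JointlyMeasurable Ω β ∧ ∀ x ∈ Ω, ∀ α β',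
        HJB.hamiltonian b c f x (z x) (fun i => q i x) α (β x α) ≤
          HJB.hamiltonian b c f x (z x) (fun i => q i x) α β') ∧
    -- every minimizing selector gives a bounded operator from `H²(Ω)` to `(L^p(Ω))^{|A|}`
    (∀ (u : HJB.H2 Ω) (β : HJB.E n → A → B), HJB.IsMinSelector b c f u β →
      ∃ M : HJB.H2 Ω →L[ℝ] HJB.LpFamily A (p : ℝ≥0∞) Ω, HJB.IsControlledOperator b c β M) ∧
    -- the HJB operator is well defined, Lipschitz continuous and semismooth
    ∃ F₁ : HJB.H2 Ω → HJB.LpFamily A (p : ℝ≥0∞) Ω,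
      (∀ u α, F₁ u α =ᵐ[HJB.leb Ω]
        fun x => ⨅ β, HJB.hamiltonian b c f x (u.fn x) (fun i => u.partialDeriv i x) α β) ∧
      (∃ K : ℝ≥0, LipschitzWith K F₁) ∧
      HJB.IsSemismooth F₁ (HJB.genDiff (p : ℝ≥0∞) b c f) Set.univ := by
  have hfin := hΩ.isFiniteMeasure
  have hΩm := hΩ.isOpen.measurableSet
  -- The `L^q` bound serves semismoothness; its weaker `L^p` consequence on the bounded domain gives
  -- the operators and the Lipschitz estimate.
  obtain ⟨q, hq2, hpq, hqn⟩ := HJB.exists_subcritical_exponent hp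
  obtain ⟨Kq, hKq⟩ := hΩ.exists_eLpNorm'_jetNorm_le hq2 hqn
  have hp1 : (1 : ℝ≥0) ≤ p := by exact_mod_cast Fact.out (p := 1 ≤ (p : ℝ≥0∞))
  obtain ⟨K, hK⟩ := HJB.eLpNorm_jetNorm_le hΩ hp1 hpq.le hKq
  have hmem := HJB.memLp_hjbValue hΩm hb hc hf hK
  refine ⟨fun u z q hz hq => ?_, fun u β hβ => ?_, ?_⟩
  · exact HJB.exists_jointlyMeasurable_argmin hΩm hb hc hf
      ((Lp.aestronglyMeasurable u.fn).aemeasurable.congr hz.symm)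
      (fun i => (Lp.aestronglyMeasurable (u.partialDeriv i)).aemeasurable.congr (hq i).symm)
  · exact HJB.exists_isControlledOperator hΩm hK hb hc hβ.1
  let F : HJB.H2 Ω → HJB.LpFamily A (p : ℝ≥0∞) Ω := fun u =>
    WithLp.toLp 1 fun α => (hmem u α).toLp
  have hF : ∀ u α, F u α =ᵐ[HJB.leb Ω] HJB.hjbValue b c f u α := fun u α =>
    (hmem u α).coeFn_toLp
  have hLip : ∃ K : ℝ≥0, LipschitzWith K F := by
    obtain ⟨C, hC0, hC⟩ := HJB.exists_ae_abs_hjbValue_sub_le hΩm hb hc hf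
    refine ⟨(Fintype.card A * (C * K)).toNNReal, LipschitzWith.of_dist_le_mul fun u v => ?_⟩
    rw [Real.coe_toNNReal _ (by positivity), dist_eq_norm, dist_eq_norm, PiLp.norm_eq_of_L1]
    calc ∑ α, ‖(F u - F v) α‖ ≤ ∑ _α : A, C * K * ‖u - v‖ := by
          refine Finset.sum_le_sum fun α _ => HJB.H2.norm_le_of_ae_abs_le hK hC0 _ _ ?_
          filter_upwards [Lp.coeFn_sub (F u α) (F v α), hF u α, hF v α, hC u v α]
            with x h1 h2 h3 h4
          rw [Pi.sub_apply, h2, h3] at h1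
          exact (congrArg abs h1).trans_le h4
      _ = _ := by
          rw [Finset.sum_const, Finset.card_univ, nsmul_eq_mul]
          ring
  refine ⟨F, hF, hLip, isOpen_univ, fun u _ => ?_, fun u _ => ?_, fun u _ ε hε => ?_⟩
  · obtain ⟨β, hβ⟩ := HJB.exists_isMinSelector hΩm hb hc hf u
    obtain ⟨M, hM⟩ := HJB.exists_isControlledOperator (p := (p : ℝ≥0∞)) hΩm hK hb hc hβ.1
    exact ⟨M, β, hβ, hM⟩
  · obtain ⟨L, hL⟩ := hLip
    exact .of_forall fun y => hL.continuous.continuousAt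
  · have hcard : (0 : ℝ) < Fintype.card A := by exact_mod_cast Fintype.card_pos
    -- The target norm is a sum over the finite set `A`, so each component is allotted `ε / |A|`.
    filter_upwards [eventually_all.2 fun α =>
      HJB.eventually_norm_sub_sub_le hΩ hb hc hf hpq hKq hF u α (div_pos hε hcard)]
      with s hs M hM
    rw [PiLp.norm_eq_of_L1]
    calc ∑ α, ‖(F (u + s) - F u - M s) α‖
        ≤ ∑ _α : A, ε / Fintype.card A * ‖s‖ := Finset.sum_le_sum fun α _ => hs α M hM
      _ = ε * ‖s‖ := by
          rw [Finset.sum_const, Finset.card_univ, nsmul_eq_mul]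
          field_simp
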